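/- Let $\theta\in(0,1)$, let $\rho(\xi)=\xi^{1+\theta}$ or $\rho(\xi)=\min(1,\xi^{1+\theta})$ for $\xi>0$, and let $\mathcal H_\rho=L^2((0,\infty);\rho(\xi)\,d\xi)$ (real-valued functions). Let $(T(t))_{t\ge 0}$ be the Dirichlet heat semigroup on $L^2(0,\infty)$, that is, $T(0)f=f$ and, for $t>0$, $$T(t)f(\xi)=\int_0^\infty \frac{1}{\sqrt{4\pi t}}\left(e^{-\frac{(\xi-\eta)^2}{4t}}-e^{-\frac{(\xi+\eta)^2}{4t}}\right)f(\eta)\,d\eta .$$ Then there is a unique $C_0$-semigroup $(e^{tA})_{t\ge0}$ on $\mathcal H_\rho$, with generator $A:\mathrm{dom}(A)\to\mathcal H_\rho$, that extends $(T(t))$ in the sense that $e^{tA}f=T(t)f$ for all $t\ge0$ and $f\in L^2(0,\infty)\cap\mathcal H_\rho$. It is bounded: $\sup_{t\ge0}\|e^{tA}\|<\infty$. It is moreover a bounded analytic semigroup: its complexification, on the complex space $L^2((0,\infty);\rho(\xi)\,d\xi)$, extends to a family of bounded operators $(e^{zA})$, $z\in\Sigma_\delta\cup\{0\}$, where $\Sigma_\delta=\{z\in\mathbb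 C\setminus\{0\}:|\arg z|<\delta\}$ for some $\delta\in(0,\pi/2]$, such that $z\mapsto e^{zA}$ is holomorphic and bounded on $\Sigma_\delta$ in the operator norm, $e^{(z+w)A}=e^{zA}e^{wA}$ for $z,w\in\Sigma_\delta$, and $e^{zA}f\to f$ as $z\to0$ in $\Sigma_\delta$ for every $f$. -/

import Mathlib

open MeasureTheory Filter Topology Set
open scoped NNReal ENNReal

/-- A `C₀` semigroup `(S t)`, `t ≥ 0`, of bounded linear operators on a normed space. -/
@[ext]
structure C0Semigroup (𝕜 E : Type*) [RCLike 𝕜] [NormedAddCommGroup E] [NormedSpace 𝕜 E] where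
  op : ℝ≥0 → E →L[𝕜] E
  op_zero : op 0 = ContinuousLinearMap.id 𝕜 E
  op_add : ∀ s t : ℝ≥0, op (s + t) = (op s).comp (op t)
  tendsto_zero : ∀ x : E, Tendsto (fun t : ℝ≥0 => op t x) (𝓝[>] 0) (𝓝 x)

namespace C0Semigroup

/-- The semigroup is (uniformly) bounded: `sup_{t ≥ 0} ‖S t‖ < ∞`. -/
def IsBounded {𝕜 E : Type*} [RCLike 𝕜] [NormedAddCommGroup E] [NormedSpace 𝕜 E]
    (S : C0Semigroup 𝕜 E) : Prop :=
  ∃ M : ℝ, ∀ t : ℝ≥0, ‖S.op t‖ ≤ M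

/-- `A` is the infinitesimal generator of `S`: its domain consists of all `x` for which
`(S t x - x) / t` converges as `t ↓ 0`, and `A x` is the limit. -/
def IsGenerator {𝕜 E : Type*} [RCLike 𝕜] [NormedAddCommGroup E] [NormedSpace 𝕜 E]
    (S : C0Semigroup 𝕜 E) (A : E →ₗ.[𝕜] E) : Prop :=
  (∀ x : E, x ∈ A.domain ↔
    ∃ y : E, Tendsto (fun t : ℝ≥0 => (((t : ℝ)⁻¹ : ℝ) : 𝕜) • (S.op t x - x)) (𝓝[>] 0) (𝓝 y)) ∧
  ∀ x : A.domain,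
    Tendsto (fun t : ℝ≥0 => (((t : ℝ)⁻¹ : ℝ) : 𝕜) • (S.op t x - (x : E))) (𝓝[>] 0) (𝓝 (A x))

end C0Semigroup

/-- The open sector `{z ≠ 0 : |arg z| < δ}`. -/
def openSector (δ : ℝ) : Set ℂ := {z | z ≠ 0 ∧ |z.arg| < δ}

/-- `S` is a bounded analytic semigroup: it extends to a family `Z z` of bounded operators indexed
by an open sector around the positive half-line (and its vertex `0`) that is holomorphic and
bounded on the sector for the operator norm, satisfies the semigroup law there, and converges
strongly to the identity as `z → 0` within the sector. -/
def C0Semigroup.IsBoundedAnalytic {E : Type*} [NormedAddCommGroup E] [NormedSpace ℂ E]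
    (S : C0Semigroup ℂ E) : Prop :=
  ∃ δ : ℝ, 0 < δ ∧ δ ≤ Real.pi / 2 ∧ ∃ Z : ℂ → E →L[ℂ] E,
    (∀ t : ℝ≥0, Z ((t : ℝ) : ℂ) = S.op t) ∧
    DifferentiableOn ℂ Z (openSector δ) ∧
    (∀ z ∈ openSector δ, ∀ w ∈ openSector δ, Z (z + w) = (Z z).comp (Z w)) ∧
    (∀ x : E, Tendsto (fun z => Z z x) (𝓝[openSector δ] 0) (𝓝 x)) ∧
    ∃ M : ℝ, ∀ z ∈ openSector δ, ‖Z z‖ ≤ M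

/-- The Dirichlet heat kernel of the half-line. -/
noncomputable def dirichletHeatKernel (t ξ η : ℝ) : ℝ :=
  1 / Real.sqrt (4 * Real.pi * t) *
    (Real.exp (-(ξ - η) ^ 2 / (4 * t)) - Real.exp (-(ξ + η) ^ 2 / (4 * t)))

/-- The Dirichlet heat semigroup of the half-line, `T(t) f`, with `T(0) f = f`. -/
noncomputable def dirichletHeat (t : ℝ≥0) (f : ℝ → ℝ) (ξ : ℝ) : ℝ :=
  if t = 0 then f ξ else ∫ η in Ioi (0 : ℝ), dirichletHeatKernel t ξ η * f η

/-- Lebesgue measure on `(0, ∞)`. -/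
noncomputable def halfLineMeasure : Measure ℝ := volume.restrict (Ioi (0 : ℝ))

/-- The measure `ρ(ξ) dξ` on `(0, ∞)`. -/
noncomputable def weightedMeasure (ρ : ℝ → ℝ) : Measure ℝ :=
  halfLineMeasure.withDensity (fun ξ => ENNReal.ofReal (ρ ξ))

/-- The real Hilbert space `L²((0, ∞); ρ(ξ) dξ)`. -/
abbrev WeightedL2 (ρ : ℝ → ℝ) : Type := Lp ℝ 2 (weightedMeasure ρ)

/-- The complex `L²((0, ∞); ρ(ξ) dξ)`, the complexification of `WeightedL2 ρ`. -/
abbrev WeightedL2C (ρ : ℝ → ℝ) : Type := Lp ℂ 2 (weightedMeasure ρ)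

/-- The inclusion of real-valued into complex-valued functions. -/
noncomputable def weightedOfReal (ρ : ℝ → ℝ) : WeightedL2 ρ →L[ℝ] WeightedL2C ρ :=
  Complex.ofRealCLM.compLpL 2 (weightedMeasure ρ)

/-- `S` extends the heat semigroup: on `L²(0, ∞) ∩ L²((0, ∞); ρ dξ)` the operator `S t` is
`T(t)`. -/
def ExtendsDirichletHeat (ρ : ℝ → ℝ) (S : C0Semigroup ℝ (WeightedL2 ρ)) : Prop :=
  ∀ (t : ℝ≥0) (f : ℝ → ℝ), MemLp f 2 halfLineMeasure →
    ∀ hf : MemLp f 2 (weightedMeasure ρ),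
      S.op t (hf.toLp f) =ᵐ[weightedMeasure ρ] dirichletHeat t f

/-- `SC` is the complexification of `S`, that is, `SC t (f + i g) = S t f + i S t g`. -/
def IsComplexification (ρ : ℝ → ℝ) (S : C0Semigroup ℝ (WeightedL2 ρ))
    (SC : C0Semigroup ℂ (WeightedL2C ρ)) : Prop :=
  ∀ (t : ℝ≥0) (f g : WeightedL2 ρ),
    SC.op t (weightedOfReal ρ f + Complex.I • weightedOfReal ρ g) =
      weightedOfReal ρ (S.op t f) + Complex.I • weightedOfReal ρ (S.op t g)

/-!
The complex-time heat kernel of the half-line with Dirichlet condition is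
`K z ξ η = G z (ξ - η) - G z (ξ + η) = G z (ξ - η) * (1 - exp (-ξη / z))`, where `G z` is the
Gaussian. Only two properties of the weight `ρ` matter: it is increasing, and `ρ ξ / ξ ^ 2` is
decreasing (`IsHeatWeight`). They give `√(ρ ξ / ρ η) ≤ max 1 (ξ / η)`, and the factor
`1 - exp (-ξη / z)`, which vanishes at the boundary, compensates the quotient `ξ / η` for small `η`
(`min_one_mul_sqrt_le`). Hence on the sector `|arg z| < π / 3` the kernel conjugated with `√ρ` is
dominated by a multiple of `‖z‖ ^ (-1/2) * exp (-(ξ - η) ^ 2 / (16 ‖z‖))`, whose integral does not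
depend on `z` (`isKernelBound_complexHeatKernel`). By Young's inequality, `K z` acts on `L²(ρ dξ)`
as an operator `heatOp ρ z`, bounded uniformly on the sector.

The semigroup law is the Chapman–Kolmogorov identity, a Gaussian integral with complex parameters
(`integral_complexHeatKernel_mul`). Holomorphy in the operator norm follows from Cauchy estimates
for the kernels pointwise in `(ξ, η)`, because a pointwise majorant of a kernel bounds the norm of
its operator (`differentiableAt_heatOp`). For strong continuity at `0`, dominated convergence along
positive times shows that the ranges of the `heatOp ρ s`, `s > 0`, are dense; on these ranges
convergence within the sector is norm continuity at `s`, and it extends to the whole space by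
boundedness (`tendsto_heatOp_zero`).

The real semigroup is the real part of the complex one, which preserves real functions. It is
unique because continuous functions with compact support lie in both `L²` spaces and are dense in
`L²(ρ dξ)`.
-/

/-! ### Young's inequality and kernel operators on the weighted space -/

/-- Cauchy–Schwarz with one factor split into square roots. -/
theorem sq_lintegral_mul_le {α : Type*} [MeasurableSpace α] (μ : Measure α) {a b : α → ℝ≥0∞}
    (ha : AEMeasurable a μ) (hb : AEMeasurable b μ) :
    (∫⁻ x, a x * b x ∂μ) ^ 2 ≤ (∫⁻ x, a x ∂μ) * ∫⁻ x, a x * b x ^ 2 ∂μ := by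
  have h := ENNReal.lintegral_mul_le_Lp_mul_Lq μ Real.HolderConjugate.two_two
    (f := fun x => a x ^ (1 / 2 : ℝ)) (g := fun x => a x ^ (1 / 2 : ℝ) * b x)
    (ha.pow_const _) ((ha.pow_const _).mul hb)
  have e0 : ∀ c : ℝ≥0∞, c ^ (1 / 2 : ℝ) * c ^ (1 / 2 : ℝ) = c := fun c => by
    rw [← ENNReal.rpow_add_of_nonneg _ _ (by norm_num) (by norm_num)]; norm_num
  have e1 : ∀ c : ℝ≥0∞, (c ^ (1 / 2 : ℝ)) ^ (2 : ℝ) = c := fun c => by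
    rw [← ENNReal.rpow_mul]; norm_num
  have e2 : ∀ c : ℝ≥0∞, (c ^ (1 / 2 : ℝ)) ^ 2 = c := fun c => by
    rw [pow_two, e0]
  simp only [Pi.mul_apply, ← mul_assoc, e0, e1, ENNReal.mul_rpow_of_nonneg _ _ (zero_le_two),
    ENNReal.rpow_two] at h
  calc _ ≤ _ := pow_le_pow_left₀ zero_le h 2
    _ = _ := by rw [mul_pow, e2, e2]

/-- Young's inequality `‖Φ ∗ g‖₂ ≤ ‖Φ‖₁ ‖g‖₂` on the line, for nonnegative functions. -/
theorem lintegral_conv_sq_le {Φ g : ℝ → ℝ≥0∞} (hΦ : Measurable Φ) (hg : Measurable g) :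
    ∫⁻ x, (∫⁻ y, Φ (x - y) * g y) ^ 2 ≤ (∫⁻ u, Φ u) ^ 2 * ∫⁻ y, g y ^ 2 := by
  have hc : ∀ x, ∫⁻ y, Φ (x - y) = ∫⁻ u, Φ u := fun x => by
    simpa using lintegral_sub_left_eq_self (μ := volume) Φ x
  have hc' : ∀ y, ∫⁻ x, Φ (x - y) = ∫⁻ u, Φ u := fun y => by
    simpa using lintegral_sub_right_eq_self (μ := volume) Φ y
  calc ∫⁻ x, (∫⁻ y, Φ (x - y) * g y) ^ 2
      ≤ ∫⁻ x, (∫⁻ u, Φ u) * ∫⁻ y, Φ (x - y) * g y ^ 2 := by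
        refine lintegral_mono fun x => ?_
        rw [← hc x]
        exact sq_lintegral_mul_le _ (by fun_prop) (by fun_prop)
    _ = (∫⁻ u, Φ u) * ∫⁻ y, ∫⁻ x, Φ (x - y) * g y ^ 2 := by
        rw [lintegral_const_mul _ (by fun_prop), lintegral_lintegral_swap (by fun_prop)]
    _ = _ := by
        have : ∀ y, ∫⁻ x, Φ (x - y) * g y ^ 2 = (∫⁻ u, Φ u) * g y ^ 2 := fun y => by
          rw [lintegral_mul_const _ (by fun_prop), hc']
        simp_rw [this]
        rw [lintegral_const_mul _ (by fun_prop), pow_two, mul_assoc]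

/-- The weights on the half-line for which the Dirichlet heat semigroup is studied: increasing, but
not faster than the square. These two conditions are invariant under dilations. -/
structure IsHeatWeight (ρ : ℝ → ℝ) : Prop where
  continuous : Continuous ρ
  pos : ∀ ξ, 0 < ξ → 0 < ρ ξ
  mono : ∀ η ξ, 0 < η → η ≤ ξ → ρ η ≤ ρ ξ
  quad : ∀ η ξ, 0 < η → η ≤ ξ → ρ ξ * η ^ 2 ≤ ρ η * ξ ^ 2

theorem IsHeatWeight.measurable {ρ : ℝ → ℝ} (hρ : IsHeatWeight ρ) : Measurable ρ :=
  hρ.continuous.measurable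

/-- The kernel `K`, conjugated with `√ρ`, is dominated on the half-line by the integrable
convolution kernel `Φ`. -/
structure IsKernelBound (ρ : ℝ → ℝ) (Φ : ℝ → ℝ) (K : ℝ → ℝ → ℂ) : Prop where
  continuous : Continuous Φ
  integrable : Integrable Φ
  nonneg : ∀ u, 0 ≤ Φ u
  le : ∀ ξ η, 0 < ξ → 0 < η → ‖K ξ η‖ * √(ρ ξ) ≤ Φ (ξ - η) * √(ρ η)

/-- The operator `T` on `L²(ρ dξ)` is given by integration over the half-line against the
kernel `K`. -/
def HasKernel (ρ : ℝ → ℝ) (T : WeightedL2C ρ →L[ℂ] WeightedL2C ρ) (K : ℝ → ℝ → ℂ) : Prop :=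
  ∀ f : WeightedL2C ρ, ∀ᵐ ξ ∂(weightedMeasure ρ),
    IntegrableOn (fun η => K ξ η * f η) (Ioi 0) ∧ T f ξ = ∫ η in Ioi 0, K ξ η * f η

theorem ae_weightedMeasure_of_ae {ρ : ℝ → ℝ} {p : ℝ → Prop}
    (h : ∀ᵐ ξ ∂halfLineMeasure, p ξ) : ∀ᵐ ξ ∂(weightedMeasure ρ), p ξ :=
  (withDensity_absolutelyContinuous _ _).ae_le h

theorem ae_weightedMeasure_of_forall_pos {ρ : ℝ → ℝ} {p : ℝ → Prop} (h : ∀ ξ, 0 < ξ → p ξ) :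
    ∀ᵐ ξ ∂(weightedMeasure ρ), p ξ :=
  ae_weightedMeasure_of_ae ((ae_restrict_iff' measurableSet_Ioi).2 (ae_of_all _ h))

theorem IsHeatWeight.ae_halfLine {ρ : ℝ → ℝ} (hρ : IsHeatWeight ρ) {p : ℝ → Prop}
    (h : ∀ᵐ ξ ∂(weightedMeasure ρ), p ξ) : ∀ᵐ ξ ∂halfLineMeasure, p ξ := by
  have := (ae_withDensity_iff (hρ.measurable.ennreal_ofReal)).1 h
  have h2 : ∀ᵐ ξ ∂halfLineMeasure, ξ ∈ Ioi (0 : ℝ) := ae_restrict_mem measurableSet_Ioi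
  filter_upwards [this, h2] with ξ h1 h2
  exact h1 (by simpa using hρ.pos ξ h2)

theorem IsHeatWeight.lintegral_weighted {ρ : ℝ → ℝ} (hρ : IsHeatWeight ρ) {f : ℝ → ℝ≥0∞}
    (hf : Measurable f) :
    ∫⁻ ξ, f ξ ^ 2 ∂(weightedMeasure ρ)
      = ∫⁻ ξ, ((Ioi (0 : ℝ)).indicator (fun ξ => f ξ * ENNReal.ofReal √(ρ ξ)) ξ) ^ 2 := by
  unfold weightedMeasure halfLineMeasure
  rw [lintegral_withDensity_eq_lintegral_mul _ hρ.measurable.ennreal_ofReal (by fun_prop),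
    ← lintegral_indicator measurableSet_Ioi]
  congr 1 with ξ
  by_cases h : ξ ∈ Ioi (0 : ℝ)
  · simp only [indicator_of_mem h, Pi.mul_apply]
    rw [mul_pow, ← ENNReal.ofReal_pow (Real.sqrt_nonneg _), Real.sq_sqrt (hρ.pos ξ h).le, mul_comm]
  · simp [indicator_of_notMem h]

/-- The Schur test: the absolute value of a kernel dominated by `Φ` acts on `L²(ρ dξ)` with norm
at most `‖Φ‖₁`. -/
theorem IsKernelBound.lintegral_sq_le {ρ : ℝ → ℝ} (hρ : IsHeatWeight ρ) {Φ : ℝ → ℝ}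
    {K : ℝ → ℝ → ℂ} (hb : IsKernelBound ρ Φ K) (hK : Measurable (Function.uncurry K))
    {f : ℝ → ℝ≥0∞} (hf : Measurable f) :
    ∫⁻ ξ, (∫⁻ η in Ioi 0, ‖K ξ η‖ₑ * f η) ^ 2 ∂(weightedMeasure ρ)
      ≤ ENNReal.ofReal (∫ u, Φ u) ^ 2 * ∫⁻ ξ, f ξ ^ 2 ∂(weightedMeasure ρ) := by
  have hm := hρ.measurable
  have hKm : Measurable fun p : ℝ × ℝ => K p.1 p.2 := hK
  have hΦ : ∫⁻ u, ENNReal.ofReal (Φ u) = ENNReal.ofReal (∫ u, Φ u) :=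
    (ofReal_integral_eq_lintegral_ofReal hb.integrable (ae_of_all _ hb.nonneg)).symm
  have hsm : Measurable fun ξ => ENNReal.ofReal √(ρ ξ) := by fun_prop
  have hg : Measurable ((Ioi (0 : ℝ)).indicator fun ξ => f ξ * ENNReal.ofReal √(ρ ξ)) :=
    (hf.mul hsm).indicator measurableSet_Ioi
  rw [hρ.lintegral_weighted hf, hρ.lintegral_weighted (by
    apply Measurable.lintegral_prod_right'
      (f := fun p : ℝ × ℝ => ‖K p.1 p.2‖ₑ * f p.2) (by fun_prop)), ← hΦ]
  refine le_trans (lintegral_mono fun ξ => ?_)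
    (lintegral_conv_sq_le (hb.continuous.measurable.ennreal_ofReal) hg)
  refine pow_le_pow_left₀ zero_le ?_ 2
  by_cases hξ : ξ ∈ Ioi (0 : ℝ)
  swap
  · simp [indicator_of_notMem hξ]
  rw [indicator_of_mem hξ, ← lintegral_mul_const _ (by fun_prop),
    ← lintegral_indicator measurableSet_Ioi]
  refine lintegral_mono fun η => ?_
  by_cases hη : η ∈ Ioi (0 : ℝ)
  swap
  · simp [indicator_of_notMem hη]
  simp only [indicator_of_mem hη]
  have := ENNReal.ofReal_le_ofReal (hb.le ξ η hξ hη)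
  rw [ENNReal.ofReal_mul (norm_nonneg _), ENNReal.ofReal_mul (hb.nonneg _), ofReal_norm] at this
  calc _ = f η * (‖K ξ η‖ₑ * ENNReal.ofReal √(ρ ξ)) := by ring
    _ ≤ f η * (ENNReal.ofReal (Φ (ξ - η)) * ENNReal.ofReal √(ρ η)) := mul_le_mul_right this _
    _ = _ := by ring

theorem eLpNorm_two_sq {α E : Type*} [MeasurableSpace α] {μ : Measure α} [NormedAddCommGroup E]
    (f : α → E) : eLpNorm f 2 μ ^ 2 = ∫⁻ x, ‖f x‖ₑ ^ 2 ∂μ := by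
  rw [eLpNorm_eq_lintegral_rpow_enorm_toReal (by norm_num) (by norm_num)]
  simp only [ENNReal.toReal_ofNat, ENNReal.rpow_two]
  rw [← ENNReal.rpow_two, ← ENNReal.rpow_mul]; norm_num

theorem IsKernelBound.ae_integrable {ρ : ℝ → ℝ} (hρ : IsHeatWeight ρ) {Φ : ℝ → ℝ}
    {K : ℝ → ℝ → ℂ} (hb : IsKernelBound ρ Φ K) (hK : Measurable (Function.uncurry K))
    {f : ℝ → ℝ≥0∞} (hf : Measurable f) (hf2 : ∫⁻ ξ, f ξ ^ 2 ∂(weightedMeasure ρ) ≠ ∞) :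
    ∀ᵐ ξ ∂(weightedMeasure ρ), ∫⁻ η in Ioi 0, ‖K ξ η‖ₑ * f η < ∞ := by
  have hKm : Measurable fun p : ℝ × ℝ => K p.1 p.2 := hK
  have h1 := hb.lintegral_sq_le hρ hK hf
  have h2 := ae_lt_top (μ := weightedMeasure ρ) (Measurable.pow_const
    (Measurable.lintegral_prod_right' (ν := volume.restrict (Ioi 0))
      (f := fun p : ℝ × ℝ => ‖K p.1 p.2‖ₑ * f p.2) (by fun_prop)) 2)
    (h1.trans_lt (ENNReal.mul_lt_top (by finiteness) hf2.lt_top)).ne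
  filter_upwards [h2] with ξ h
  by_contra h3
  simp [not_lt_top_iff.1 h3] at h

theorem lintegral_enorm_sq_ne_top {α E : Type*} [MeasurableSpace α] {μ : Measure α}
    [NormedAddCommGroup E] (f : Lp E 2 μ) : ∫⁻ x, ‖f x‖ₑ ^ 2 ∂μ ≠ ∞ := by
  rw [← eLpNorm_two_sq]
  exact (ENNReal.pow_lt_top (Lp.memLp f).2).ne

theorem IsKernelBound.ae_integrableOn {ρ : ℝ → ℝ} (hρ : IsHeatWeight ρ) {Φ : ℝ → ℝ}
    {K : ℝ → ℝ → ℂ} (hb : IsKernelBound ρ Φ K) (hK : Measurable (Function.uncurry K))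
    (f : WeightedL2C ρ) :
    ∀ᵐ ξ ∂(weightedMeasure ρ), IntegrableOn (fun η => K ξ η * f η) (Ioi 0) := by
  have hKm : Measurable fun p : ℝ × ℝ => K p.1 p.2 := hK
  have hfm := (Lp.stronglyMeasurable f).measurable
  filter_upwards [hb.ae_integrable hρ hK (f := fun η => ‖f η‖ₑ) (by fun_prop)
    (lintegral_enorm_sq_ne_top f)] with ξ h
  refine ⟨by fun_prop, ?_⟩
  simpa only [HasFiniteIntegral, enorm_mul] using h

theorem IsKernelBound.eLpNorm_le {ρ : ℝ → ℝ} (hρ : IsHeatWeight ρ) {Φ : ℝ → ℝ}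
    {K : ℝ → ℝ → ℂ} (hb : IsKernelBound ρ Φ K) (hK : Measurable (Function.uncurry K))
    (f : WeightedL2C ρ) :
    eLpNorm (fun ξ => ∫ η in Ioi 0, K ξ η * f η) 2 (weightedMeasure ρ)
      ≤ ENNReal.ofReal (∫ u, Φ u) * ‖f‖ₑ := by
  have hfm := (Lp.stronglyMeasurable f).measurable
  rw [← ENNReal.pow_le_pow_left_iff two_ne_zero, mul_pow, Lp.enorm_def, eLpNorm_two_sq,
    eLpNorm_two_sq]
  refine le_trans (lintegral_mono fun ξ => ?_) (hb.lintegral_sq_le hρ hK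
    (f := fun η => ‖f η‖ₑ) (by fun_prop))
  refine pow_le_pow_left₀ zero_le ?_ 2
  refine (enorm_integral_le_lintegral_enorm _).trans_eq ?_
  simp only [enorm_mul]

theorem IsKernelBound.memLp {ρ : ℝ → ℝ} (hρ : IsHeatWeight ρ) {Φ : ℝ → ℝ}
    {K : ℝ → ℝ → ℂ} (hb : IsKernelBound ρ Φ K) (hK : Measurable (Function.uncurry K))
    (f : WeightedL2C ρ) :
    MemLp (fun ξ => ∫ η in Ioi 0, K ξ η * f η) 2 (weightedMeasure ρ) := by
  have hKm : Measurable fun p : ℝ × ℝ => K p.1 p.2 := hK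
  have hfm := (Lp.stronglyMeasurable f).measurable
  refine ⟨(StronglyMeasurable.integral_prod_right' (f := fun p : ℝ × ℝ => K p.1 p.2 * f p.2)
    (by fun_prop)).aestronglyMeasurable, (hb.eLpNorm_le hρ hK f).trans_lt ?_⟩
  finiteness

theorem HasKernel.norm_le {ρ : ℝ → ℝ} (hρ : IsHeatWeight ρ) {Φ : ℝ → ℝ}
    {K : ℝ → ℝ → ℂ} {T : WeightedL2C ρ →L[ℂ] WeightedL2C ρ} (hT : HasKernel ρ T K)
    (hb : IsKernelBound ρ Φ K) (hK : Measurable (Function.uncurry K)) : ‖T‖ ≤ ∫ u, Φ u := by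
  have h0 : 0 ≤ ∫ u, Φ u := integral_nonneg hb.nonneg
  refine T.opNorm_le_bound h0 fun f => ?_
  have h := hb.eLpNorm_le hρ hK f
  rw [← eLpNorm_congr_ae ((hT f).mono fun ξ h => h.2), ← Lp.enorm_def] at h
  rw [← ENNReal.ofReal_le_ofReal_iff (by positivity), ENNReal.ofReal_mul h0, ofReal_norm,
    ofReal_norm]
  exact h

theorem IsKernelBound.exists_hasKernel {ρ : ℝ → ℝ} (hρ : IsHeatWeight ρ) {Φ : ℝ → ℝ}
    {K : ℝ → ℝ → ℂ} (hb : IsKernelBound ρ Φ K) (hK : Measurable (Function.uncurry K)) :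
    ∃ T : WeightedL2C ρ →L[ℂ] WeightedL2C ρ, HasKernel ρ T K := by
  have hint := hb.ae_integrableOn hρ hK
  let T₀ : WeightedL2C ρ →ₗ[ℂ] WeightedL2C ρ :=
    { toFun := fun f => (hb.memLp hρ hK f).toLp _
      map_add' := fun f g => by
        rw [← MemLp.toLp_add, MemLp.toLp_eq_toLp_iff]
        filter_upwards [hint f, hint g] with ξ h1 h2
        rw [Pi.add_apply, ← integral_add h1 h2]
        refine integral_congr_ae ?_
        filter_upwards [hρ.ae_halfLine (Lp.coeFn_add f g)] with η h
        rw [h, Pi.add_apply, mul_add]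
      map_smul' := fun c f => by
        rw [RingHom.id_apply, ← MemLp.toLp_const_smul, MemLp.toLp_eq_toLp_iff]
        refine ae_of_all _ fun ξ => ?_
        rw [Pi.smul_apply, ← integral_smul]
        refine integral_congr_ae ?_
        filter_upwards [hρ.ae_halfLine (Lp.coeFn_smul c f)] with η h
        rw [h, Pi.smul_apply, smul_eq_mul, smul_eq_mul]
        ring }
  have h0 : 0 ≤ ∫ u, Φ u := integral_nonneg hb.nonneg
  refine ⟨T₀.mkContinuous (∫ u, Φ u) fun f => ?_, fun f => ?_⟩
  · rw [← ENNReal.ofReal_le_ofReal_iff (by positivity), ENNReal.ofReal_mul h0, ofReal_norm,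
      ofReal_norm]
    refine le_trans (le_of_eq ?_) (hb.eLpNorm_le hρ hK f)
    exact Lp.enorm_toLp (hb.memLp hρ hK f)
  · filter_upwards [hint f, (hb.memLp hρ hK f).coeFn_toLp] with ξ h1 h2
    exact ⟨h1, h2⟩

theorem HasKernel.sub {ρ : ℝ → ℝ} {T₁ T₂ : WeightedL2C ρ →L[ℂ] WeightedL2C ρ}
    {K₁ K₂ : ℝ → ℝ → ℂ} (h₁ : HasKernel ρ T₁ K₁) (h₂ : HasKernel ρ T₂ K₂) :
    HasKernel ρ (T₁ - T₂) (fun ξ η => K₁ ξ η - K₂ ξ η) := fun f => by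
  filter_upwards [h₁ f, h₂ f, Lp.coeFn_sub (T₁ f) (T₂ f)] with ξ h1 h2 h3
  simp only [sub_mul]
  refine ⟨h1.1.sub h2.1, ?_⟩
  rw [_root_.sub_apply, h3, Pi.sub_apply, h1.2, h2.2]
  exact (integral_sub h1.1 h2.1).symm

theorem HasKernel.smul {ρ : ℝ → ℝ} {T : WeightedL2C ρ →L[ℂ] WeightedL2C ρ}
    {K : ℝ → ℝ → ℂ} (h : HasKernel ρ T K) (c : ℂ) :
    HasKernel ρ (c • T) (fun ξ η => c * K ξ η) := fun f => by
  filter_upwards [h f, Lp.coeFn_smul c (T f)] with ξ h1 h3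
  simp only [mul_assoc]
  refine ⟨h1.1.const_mul c, ?_⟩
  rw [_root_.smul_apply, h3, Pi.smul_apply, h1.2, smul_eq_mul]
  exact (integral_const_mul _ _).symm

theorem HasKernel.congr {ρ : ℝ → ℝ} {T : WeightedL2C ρ →L[ℂ] WeightedL2C ρ}
    {K K' : ℝ → ℝ → ℂ} (h : HasKernel ρ T K)
    (hK : ∀ ξ η, 0 < ξ → 0 < η → K ξ η = K' ξ η) : HasKernel ρ T K' := fun f => by
  filter_upwards [h f, ae_weightedMeasure_of_forall_pos (p := fun ξ => 0 < ξ) fun ξ h => h]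
    with ξ h1 hξ
  have e : EqOn (fun η => K ξ η * f η) (fun η => K' ξ η * f η) (Ioi 0) :=
    fun η hη => by simp only [hK ξ η hξ hη]
  exact ⟨h1.1.congr_fun e measurableSet_Ioi,
    h1.2.trans (setIntegral_congr_fun measurableSet_Ioi e)⟩

theorem HasKernel.ext {ρ : ℝ → ℝ} {T T' : WeightedL2C ρ →L[ℂ] WeightedL2C ρ}
    {K : ℝ → ℝ → ℂ} (h : HasKernel ρ T K) (h' : HasKernel ρ T' K) : T = T' := by
  ext1 f
  refine Lp.ext ?_
  filter_upwards [h f, h' f] with ξ h1 h2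
  rw [h1.2, h2.2]

/-- The kernel of a product of kernel operators, by Fubini's theorem; the Schur test, applied
twice, gives the absolute convergence of the double integral. -/
theorem HasKernel.comp {ρ : ℝ → ℝ} (hρ : IsHeatWeight ρ)
    {T₁ T₂ : WeightedL2C ρ →L[ℂ] WeightedL2C ρ}
    {K₁ K₂ : ℝ → ℝ → ℂ} {Φ₁ Φ₂ : ℝ → ℝ} (h₁ : HasKernel ρ T₁ K₁) (h₂ : HasKernel ρ T₂ K₂)
    (hb₁ : IsKernelBound ρ Φ₁ K₁) (hb₂ : IsKernelBound ρ Φ₂ K₂)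
    (hK₁ : Measurable (Function.uncurry K₁)) (hK₂ : Measurable (Function.uncurry K₂)) :
    HasKernel ρ (T₁.comp T₂) (fun ξ η => ∫ ζ in Ioi 0, K₁ ξ ζ * K₂ ζ η) := fun f => by
  have hKm₁ : Measurable fun p : ℝ × ℝ => K₁ p.1 p.2 := hK₁
  have hKm₂ : Measurable fun p : ℝ × ℝ => K₂ p.1 p.2 := hK₂
  have hfm := (Lp.stronglyMeasurable f).measurable
  have hfin := lintegral_enorm_sq_ne_top f
  have hmeas : Measurable fun ζ => ∫⁻ η in Ioi 0, ‖K₂ ζ η‖ₑ * ‖f η‖ₑ :=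
    Measurable.lintegral_prod_right'
      (f := fun p : ℝ × ℝ => ‖K₂ p.1 p.2‖ₑ * ‖f p.2‖ₑ) (by fun_prop)
  have hfin2 := (hb₂.lintegral_sq_le hρ hK₂ (f := fun η => ‖f η‖ₑ) (by fun_prop)).trans_lt
    (ENNReal.mul_lt_top (by finiteness) hfin.lt_top)
  filter_upwards [h₁ (T₂ f), hb₁.ae_integrable hρ hK₁ hmeas hfin2.ne] with ξ h1 h3
  have hprod : Integrable (Function.uncurry fun ζ η => K₁ ξ ζ * K₂ ζ η * f η)
      ((volume.restrict (Ioi (0 : ℝ))).prod (volume.restrict (Ioi (0 : ℝ)))) := by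
    have hm : Measurable (Function.uncurry fun ζ η => K₁ ξ ζ * K₂ ζ η * f η) := by
      unfold Function.uncurry; fun_prop
    refine ⟨hm.aestronglyMeasurable, ?_⟩
    rw [HasFiniteIntegral, lintegral_prod _ (by fun_prop)]
    refine lt_of_eq_of_lt (lintegral_congr fun ζ => ?_) h3
    rw [← lintegral_const_mul _ (by fun_prop)]
    simp only [Function.uncurry, enorm_mul, mul_assoc]
  have hswap := integral_integral_swap hprod
  simp only [mul_assoc] at hswap
  have e : ∀ η, (∫ ζ in Ioi 0, K₁ ξ ζ * K₂ ζ η) * f η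
      = ∫ ζ in Ioi 0, K₁ ξ ζ * (K₂ ζ η * f η) := fun η => by
    rw [← integral_mul_const]; simp only [mul_assoc]
  simp only [e]
  refine ⟨by simpa only [Function.uncurry, mul_assoc] using! hprod.integral_prod_right, ?_⟩
  rw [ContinuousLinearMap.comp_apply, h1.2, ← hswap]
  refine integral_congr_ae ?_
  filter_upwards [hρ.ae_halfLine (h₂ f)] with ζ hζ
  rw [hζ.2]
  exact (integral_const_mul _ _).symm

/-! ### The complex heat kernel -/

/-- A convex open cone around the positive half-line, namely the sector `|arg z| < π / 3`. On it
`re (1 / z) ≥ 1 / (2 ‖z‖)`. -/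
def heatCone : Set ℂ := {z | ‖z‖ < 2 * z.re}

theorem heatCone.re_pos {z : ℂ} (hz : z ∈ heatCone) : 0 < z.re := by
  have := norm_nonneg z
  have h : ‖z‖ < 2 * z.re := hz
  linarith

theorem heatCone.ne_zero {z : ℂ} (hz : z ∈ heatCone) : z ≠ 0 := by
  rintro rfl
  simpa using heatCone.re_pos hz

theorem heatCone.norm_pos {z : ℂ} (hz : z ∈ heatCone) : 0 < ‖z‖ :=
  norm_pos_iff.2 (heatCone.ne_zero hz)

theorem heatCone.add {z w : ℂ} (hz : z ∈ heatCone) (hw : w ∈ heatCone) : z + w ∈ heatCone := by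
  have h1 : ‖z‖ < 2 * z.re := hz
  have h2 : ‖w‖ < 2 * w.re := hw
  have := norm_add_le z w
  change ‖z + w‖ < 2 * (z + w).re
  rw [Complex.add_re]
  linarith

theorem isOpen_heatCone : IsOpen heatCone :=
  isOpen_lt continuous_norm (continuous_const.mul Complex.continuous_re)

theorem ofReal_mem_heatCone {t : ℝ} (ht : 0 < t) : (t : ℂ) ∈ heatCone := by
  change ‖(t : ℂ)‖ < 2 * (t : ℂ).re
  rw [Complex.norm_real, Real.norm_of_nonneg ht.le, Complex.ofReal_re]
  linarith

theorem openSector_subset_heatCone : openSector (Real.pi / 3) ⊆ heatCone := by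
  rintro z ⟨hz, h⟩
  change ‖z‖ < 2 * z.re
  have hp := Real.pi_pos
  have h1 : Real.cos (Real.pi / 3) < Real.cos |z.arg| :=
    Real.cos_lt_cos_of_nonneg_of_le_pi (abs_nonneg _) (by linarith) h
  rw [Real.cos_abs, Real.cos_pi_div_three] at h1
  have h2 : ‖z‖ * Real.cos z.arg = z.re := Complex.norm_mul_cos_arg z
  have h3 := norm_pos_iff.2 hz
  nlinarith

/-- The complex heat kernel `(4πz)^{-1/2} e^{-u² / 4z}` of the line. -/
noncomputable def heatGaussian (z : ℂ) (u : ℝ) : ℂ :=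
  (4 * Real.pi * z) ^ (-(1 / 2) : ℂ) * Complex.exp (-(u : ℂ) ^ 2 / (4 * z))

/-- The Dirichlet heat kernel of the half-line at complex time. -/
noncomputable def complexHeatKernel (z : ℂ) (ξ η : ℝ) : ℂ :=
  heatGaussian z (ξ - η) - heatGaussian z (ξ + η)

theorem heatGaussian_neg (z : ℂ) (u : ℝ) : heatGaussian z (-u) = heatGaussian z u := by
  simp [heatGaussian]

theorem heatGaussian_ofReal {t : ℝ} (ht : 0 < t) (u : ℝ) :
    heatGaussian t u = ((1 / √(4 * Real.pi * t) * Real.exp (-u ^ 2 / (4 * t)) : ℝ) : ℂ) := by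
  have h : (4 * Real.pi * (t : ℂ)) ^ (-(1 / 2) : ℂ) = ((1 / √(4 * Real.pi * t) : ℝ) : ℂ) := by
    have hp := Real.pi_pos
    rw [Real.sqrt_eq_rpow, one_div ((4 * Real.pi * t) ^ (1 / 2 : ℝ)),
      ← Real.rpow_neg (by positivity), Complex.ofReal_cpow (by positivity)]
    push_cast
    rfl
  rw [heatGaussian, h]
  push_cast
  rfl

theorem complexHeatKernel_ofReal {t : ℝ} (ht : 0 < t) (ξ η : ℝ) :
    complexHeatKernel t ξ η = (dirichletHeatKernel t ξ η : ℂ) := by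
  rw [complexHeatKernel, heatGaussian_ofReal ht, heatGaussian_ofReal ht, dirichletHeatKernel,
    ← Complex.ofReal_sub, mul_sub]

theorem continuous_heatGaussian (z : ℂ) : Continuous (heatGaussian z) := by
  unfold heatGaussian
  fun_prop

theorem measurable_complexHeatKernel (z : ℂ) :
    Measurable (Function.uncurry (complexHeatKernel z)) := by
  have := continuous_heatGaussian z
  unfold complexHeatKernel Function.uncurry
  exact Continuous.measurable (by fun_prop)

theorem cpow_mul_cpow_of_re_pos {a b : ℂ} (ha : 0 < a.re) (hb : 0 < b.re) (s : ℂ) :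
    a ^ s * b ^ s = (a * b) ^ s := by
  have ha0 : a ≠ 0 := by rintro rfl; simp at ha
  have hb0 : b ≠ 0 := by rintro rfl; simp at hb
  have h1 := abs_lt.1 (Complex.abs_arg_lt_pi_div_two_iff.2 (Or.inl ha))
  have h2 := abs_lt.1 (Complex.abs_arg_lt_pi_div_two_iff.2 (Or.inl hb))
  rw [Complex.cpow_def_of_ne_zero ha0, Complex.cpow_def_of_ne_zero hb0,
    Complex.cpow_def_of_ne_zero (mul_ne_zero ha0 hb0), ← Complex.exp_add,
    Complex.log_mul ha0 hb0 ⟨by linarith, by linarith⟩, add_mul]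

theorem re_inv_pos {z : ℂ} (hz : 0 < z.re) : 0 < (z⁻¹).re := by
  have : z ≠ 0 := by rintro rfl; simp at hz
  rw [Complex.inv_re]
  exact div_pos hz (Complex.normSq_pos.2 this)

theorem re_four_pi_mul_pos {z : ℂ} (hz : 0 < z.re) : 0 < (4 * Real.pi * z).re := by
  have : (4 * Real.pi * z).re = 4 * Real.pi * z.re := by simp
  rw [this]
  have := Real.pi_pos
  positivity

/-- The integrand of the Chapman–Kolmogorov identity on the line, as a Gaussian in `y`. -/
theorem heatGaussian_mul_eq (z w : ℂ) (x v y : ℝ) :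
    heatGaussian z (x - y) * heatGaussian w (y - v)
      = (4 * Real.pi * z) ^ (-(1 / 2) : ℂ) * (4 * Real.pi * w) ^ (-(1 / 2) : ℂ) *
        Complex.exp (-(z⁻¹ / 4 + w⁻¹ / 4) * (y : ℂ) ^ 2 + (x * z⁻¹ / 2 + v * w⁻¹ / 2) * y
          + (-x ^ 2 * z⁻¹ / 4 - v ^ 2 * w⁻¹ / 4)) := by
  rw [heatGaussian, heatGaussian, mul_mul_mul_comm, ← Complex.exp_add]
  congr 2
  push_cast
  simp only [div_eq_mul_inv, mul_inv]
  ring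

theorem re_neg_inv_add_inv {z w : ℂ} (hz : 0 < z.re) (hw : 0 < w.re) :
    (-(z⁻¹ / 4 + w⁻¹ / 4)).re < 0 := by
  have h1 := re_inv_pos hz
  have h2 := re_inv_pos hw
  have e : -(z⁻¹ / 4 + w⁻¹ / 4) = ((-(1 / 4) : ℝ) : ℂ) * (z⁻¹ + w⁻¹) := by push_cast; ring
  rw [e, Complex.re_ofReal_mul, Complex.add_re]
  linarith

theorem integrable_heatGaussian_mul {z w : ℂ} (hz : 0 < z.re) (hw : 0 < w.re) (x v : ℝ) :
    Integrable fun y => heatGaussian z (x - y) * heatGaussian w (y - v) := by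
  simp only [heatGaussian_mul_eq]
  exact (integrable_cexp_quadratic' (re_neg_inv_add_inv hz hw) _ _).const_mul _

theorem integral_heatGaussian_mul {z w : ℂ} (hz : 0 < z.re) (hw : 0 < w.re) (x v : ℝ) :
    ∫ y, heatGaussian z (x - y) * heatGaussian w (y - v) = heatGaussian (z + w) (x - v) := by
  have hz0 : z ≠ 0 := by rintro rfl; simp at hz
  have hw0 : w ≠ 0 := by rintro rfl; simp at hw
  have hzw : 0 < (z + w).re := by rw [Complex.add_re]; positivity
  have hzw0 : z + w ≠ 0 := by intro h; simp [h] at hzw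
  have hpi : (Real.pi : ℂ) ≠ 0 := by exact_mod_cast Real.pi_ne_zero
  simp only [heatGaussian_mul_eq]
  rw [integral_const_mul, integral_cexp_quadratic (re_neg_inv_add_inv hz hw), heatGaussian,
    ← mul_assoc]
  set q : ℂ := Real.pi / - -(z⁻¹ / 4 + w⁻¹ / 4) with hq
  have hqre : 0 < q.re := by
    have e : q = (Real.pi : ℂ) * (z⁻¹ / 4 + w⁻¹ / 4)⁻¹ := by rw [hq, neg_neg, div_eq_mul_inv]
    rw [e, Complex.re_ofReal_mul]
    refine mul_pos Real.pi_pos (re_inv_pos ?_)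
    have := re_neg_inv_add_inv hz hw
    rw [Complex.neg_re] at this
    linarith
  have hsum : z⁻¹ / 4 + w⁻¹ / 4 ≠ 0 := by
    intro h
    have := re_neg_inv_add_inv hz hw
    simp [h] at this
  have hq0 : q ≠ 0 := by intro h; simp [h] at hqre
  have hprod : 4 * Real.pi * z * (4 * Real.pi * w) = q * (4 * Real.pi * (z + w)) := by
    have : z⁻¹ / 4 + w⁻¹ / 4 = (z + w) / (4 * z * w) := by field_simp; ring
    rw [hq, neg_neg, this]
    field_simp
  -- All four factors lie in the right half-plane, so the principal square roots multiply.
  have hpre : (4 * Real.pi * z) ^ (-(1 / 2) : ℂ) * (4 * Real.pi * w) ^ (-(1 / 2) : ℂ)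
      * q ^ (1 / 2 : ℂ) = (4 * Real.pi * (z + w)) ^ (-(1 / 2) : ℂ) := by
    rw [cpow_mul_cpow_of_re_pos (re_four_pi_mul_pos hz) (re_four_pi_mul_pos hw), hprod,
      ← cpow_mul_cpow_of_re_pos hqre (re_four_pi_mul_pos hzw), Complex.cpow_neg q]
    have : q ^ (1 / 2 : ℂ) ≠ 0 := by simp [Complex.cpow_eq_zero_iff, hq0]
    field_simp
  rw [hpre]
  congr 2
  have e : z⁻¹ / 4 + w⁻¹ / 4 = (z + w) / (4 * z * w) := by field_simp; ring
  rw [e]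
  push_cast
  field_simp
  ring

theorem complexHeatKernel_neg_right (z : ℂ) (ξ η : ℝ) :
    complexHeatKernel z ξ (-η) = -complexHeatKernel z ξ η := by
  simp [complexHeatKernel, sub_eq_add_neg]

theorem complexHeatKernel_neg_left (z : ℂ) (ξ η : ℝ) :
    complexHeatKernel z (-ξ) η = -complexHeatKernel z ξ η := by
  rw [complexHeatKernel, complexHeatKernel, ← heatGaussian_neg z (-ξ - η),
    ← heatGaussian_neg z (-ξ + η), neg_sub]
  ring_nf

/-- The Chapman–Kolmogorov identity on the half-line: the integrand is even in `ζ`, so the integral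
is half of that over the line. -/
theorem integral_complexHeatKernel_mul {z w : ℂ} (hz : 0 < z.re) (hw : 0 < w.re) (ξ η : ℝ) :
    ∫ ζ in Ioi 0, complexHeatKernel z ξ ζ * complexHeatKernel w ζ η
      = complexHeatKernel (z + w) ξ η := by
  have e : ∀ ζ, complexHeatKernel z ξ ζ * complexHeatKernel w ζ η
      = heatGaussian z (ξ - ζ) * heatGaussian w (ζ - η)
        - heatGaussian z (ξ - ζ) * heatGaussian w (ζ - -η)
        - (heatGaussian z (-ξ - ζ) * heatGaussian w (ζ - η)
        - heatGaussian z (-ξ - ζ) * heatGaussian w (ζ - -η)) := fun ζ => by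
    rw [complexHeatKernel, complexHeatKernel, ← heatGaussian_neg z (ξ + ζ), neg_add', sub_neg_eq_add]
    ring
  have hi := fun x v => integrable_heatGaussian_mul hz hw x v
  have hd : ∀ x, Integrable fun y => heatGaussian z (x - y) * heatGaussian w (y - η)
      - heatGaussian z (x - y) * heatGaussian w (y - -η) := fun x => (hi x _).sub (hi x _)
  have hfull : ∫ ζ, complexHeatKernel z ξ ζ * complexHeatKernel w ζ η
      = 2 * complexHeatKernel (z + w) ξ η := by
    simp only [e]
    rw [integral_sub (hd _) (hd _), integral_sub (hi _ _) (hi _ _),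
      integral_sub (hi _ _) (hi _ _)]
    simp only [integral_heatGaussian_mul hz hw, complexHeatKernel]
    rw [← heatGaussian_neg _ (-ξ - η), ← heatGaussian_neg _ (-ξ - -η)]
    simp only [sub_neg_eq_add, neg_sub, neg_add_rev, neg_neg]
    rw [add_comm η ξ, neg_add_eq_sub, show ξ - η = -η + ξ by ring]
    ring
  have hint : Integrable fun ζ => complexHeatKernel z ξ ζ * complexHeatKernel w ζ η := by
    simp only [e]
    exact (hd _).sub (hd _)
  have heven := integral_comp_neg_Ioi 0
    fun ζ => complexHeatKernel z ξ ζ * complexHeatKernel w ζ η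
  simp only [complexHeatKernel_neg_right, complexHeatKernel_neg_left, neg_mul_neg, neg_zero]
    at heven
  have hsplit := intervalIntegral.integral_Iic_add_Ioi (b := 0) hint.integrableOn hint.integrableOn
  rw [hfull, ← heven, ← two_mul] at hsplit
  exact mul_left_cancel₀ two_ne_zero hsplit

/-! ### Weighted bounds of the heat kernel -/

/-- The dilation-invariant comparison behind the boundedness of the semigroup: the vanishing of the
kernel at the boundary compensates the growth of the weight. -/
theorem min_one_mul_sqrt_le {ρ : ℝ → ℝ} (hρ : IsHeatWeight ρ) {r ξ η : ℝ} (hr : 0 < r)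
    (hξ : 0 < ξ) (hη : 0 < η) :
    min 1 (ξ * η / r) * √(ρ ξ) ≤ (1 + |ξ - η| / √r) ^ 2 * √(ρ η) := by
  have hρη := hρ.pos η hη
  have hs : 0 < √r := Real.sqrt_pos.2 hr
  have hss : √r * √r = r := Real.mul_self_sqrt hr.le
  rcases le_total ξ η with h | h
  · have h1 : √(ρ ξ) ≤ √(ρ η) := Real.sqrt_le_sqrt (hρ.mono ξ η hξ h)
    have h2 : (1 : ℝ) ≤ (1 + |ξ - η| / √r) ^ 2 := one_le_pow₀ (by
      have : 0 ≤ |ξ - η| / √r := by positivity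
      linarith)
    exact mul_le_mul ((min_le_left _ _).trans h2) h1 (Real.sqrt_nonneg _) (by positivity)
  · have h1 : √(ρ ξ) ≤ ξ / η * √(ρ η) := by
      rw [← Real.sqrt_sq (div_pos hξ hη).le, ← Real.sqrt_mul (by positivity)]
      refine Real.sqrt_le_sqrt ?_
      rw [div_pow, div_mul_eq_mul_div, le_div_iff₀ (by positivity), mul_comm (ξ ^ 2)]
      exact hρ.quad η ξ hη h
    have h2 : min 1 (ξ * η / r) * (ξ / η) ≤ (1 + |ξ - η| / √r) ^ 2 := by
      rw [abs_of_nonneg (sub_nonneg.2 h)]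
      have h0 : 0 ≤ (ξ - η) / √r := div_nonneg (sub_nonneg.2 h) hs.le
      rcases le_total √r η with h3 | h3
      · have : ξ / η ≤ 1 + (ξ - η) / √r := by
          have : (ξ - η) / η ≤ (ξ - η) / √r :=
            div_le_div_of_nonneg_left (sub_nonneg.2 h) hs h3
          have e : (ξ - η) / η = ξ / η - 1 := by field_simp
          linarith
        calc min 1 (ξ * η / r) * (ξ / η) ≤ 1 * (ξ / η) := by
              gcongr; exact min_le_left _ _
          _ ≤ 1 + (ξ - η) / √r := by linarith
          _ ≤ _ := by nlinarith
      · have h4 : ξ / √r ≤ 1 + (ξ - η) / √r := by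
          have e : 1 + (ξ - η) / √r = ξ / √r + (√r - η) / √r := by field_simp; ring
          have : 0 ≤ (√r - η) / √r := div_nonneg (sub_nonneg.2 h3) hs.le
          linarith
        calc min 1 (ξ * η / r) * (ξ / η) ≤ ξ * η / r * (ξ / η) := by
              gcongr; exact min_le_right _ _
          _ = (ξ / √r) ^ 2 := by
              rw [div_pow, Real.sq_sqrt hr.le]; field_simp
          _ ≤ _ := by gcongr
    calc _ ≤ min 1 (ξ * η / r) * (ξ / η * √(ρ η)) := by gcongr
      _ = min 1 (ξ * η / r) * (ξ / η) * √(ρ η) := by ring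
      _ ≤ _ := by gcongr

theorem heatCone.le_re_inv {z : ℂ} (hz : z ∈ heatCone) : 1 / (2 * ‖z‖) ≤ (z⁻¹).re := by
  have h : ‖z‖ < 2 * z.re := hz
  have h0 := heatCone.norm_pos hz
  rw [Complex.inv_re, Complex.normSq_eq_norm_sq, div_le_div_iff₀ (by positivity) (by positivity)]
  nlinarith

theorem norm_heatGaussian_le {z : ℂ} (hz : z ∈ heatCone) (u : ℝ) :
    ‖heatGaussian z u‖ ≤ (√‖z‖)⁻¹ * Real.exp (-u ^ 2 / (8 * ‖z‖)) := by
  have h0 := heatCone.norm_pos hz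
  have hp := Real.pi_gt_three
  rw [heatGaussian, norm_mul, Complex.norm_exp]
  refine mul_le_mul ?_ (Real.exp_le_exp.2 ?_) (Real.exp_pos _).le (by positivity)
  · have e : (-(1 / 2) : ℂ) = ((-(1 / 2) : ℝ) : ℂ) := by push_cast; rfl
    rw [e, Complex.norm_cpow_real, Real.rpow_neg (norm_nonneg _), ← Real.sqrt_eq_rpow]
    refine inv_anti₀ (Real.sqrt_pos.2 h0) (Real.sqrt_le_sqrt ?_)
    rw [norm_mul, norm_mul, Complex.norm_real, Real.norm_of_nonneg (by positivity)]
    norm_num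
    nlinarith
  · have e : -(u : ℂ) ^ 2 / (4 * z) = ((-u ^ 2 / 4 : ℝ) : ℂ) * z⁻¹ := by
      push_cast
      simp only [div_eq_mul_inv, mul_inv]
      ring
    rw [e, Complex.re_ofReal_mul]
    have h1 := heatCone.le_re_inv hz
    have h2 : -u ^ 2 / (8 * ‖z‖) = (-u ^ 2 / 4) * (1 / (2 * ‖z‖)) := by field_simp; ring
    rw [h2]
    refine mul_le_mul_of_nonpos_left h1 ?_
    nlinarith [sq_nonneg u]

theorem norm_one_sub_exp_neg_le {w : ℂ} (hw : 0 ≤ w.re) :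
    ‖1 - Complex.exp (-w)‖ ≤ 2 * min 1 ‖w‖ := by
  rcases le_total ‖w‖ 1 with h | h
  · rw [min_eq_right h, norm_sub_rev]
    simpa using Complex.norm_exp_sub_one_le (x := -w) (by simpa using h)
  · rw [min_eq_left h]
    refine (norm_sub_le _ _).trans ?_
    rw [norm_one, Complex.norm_exp, Complex.neg_re]
    have : Real.exp (-w.re) ≤ 1 := Real.exp_le_one_iff.2 (by linarith)
    linarith

theorem norm_complexHeatKernel_le {z : ℂ} (hz : z ∈ heatCone) {ξ η : ℝ} (hξ : 0 < ξ) (hη : 0 < η) :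
    ‖complexHeatKernel z ξ η‖
      ≤ (√‖z‖)⁻¹ * Real.exp (-(ξ - η) ^ 2 / (8 * ‖z‖)) * (2 * min 1 (ξ * η / ‖z‖)) := by
  have h0 := heatCone.ne_zero hz
  have e : complexHeatKernel z ξ η
      = heatGaussian z (ξ - η) * (1 - Complex.exp (-(((ξ * η : ℝ) : ℂ) * z⁻¹))) := by
    rw [complexHeatKernel, mul_sub, mul_one]
    congr 1
    rw [heatGaussian, heatGaussian, mul_assoc (_ ^ _), ← Complex.exp_add]
    congr 2
    push_cast
    field_simp
    ring
  rw [e, norm_mul]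
  refine mul_le_mul (norm_heatGaussian_le hz _) ?_ (norm_nonneg _) (by positivity)
  refine (norm_one_sub_exp_neg_le ?_).trans_eq ?_
  · rw [Complex.re_ofReal_mul]
    have := re_inv_pos (heatCone.re_pos hz)
    positivity
  · rw [norm_mul, norm_inv, Complex.norm_real, Real.norm_of_nonneg (by positivity), div_eq_mul_inv]

/-- The Gaussian that dominates the weighted heat kernel at complex times `z` with
`a ≤ ‖z‖ ≤ b`. The range of moduli is needed for a majorant common to all times near a given
one. -/
noncomputable def heatMajorant (a b u : ℝ) : ℝ := 68 * (√a)⁻¹ * Real.exp (-(16 * b)⁻¹ * u ^ 2)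

/-- Half of the Gaussian decay absorbs the polynomial factor of `min_one_mul_sqrt_le`. -/
theorem one_add_sq_mul_exp_le {r : ℝ} (hr : 0 < r) (u : ℝ) :
    (1 + |u| / √r) ^ 2 * Real.exp (-u ^ 2 / (8 * r)) ≤ 34 * Real.exp (-(16 * r)⁻¹ * u ^ 2) := by
  set v := |u| / √r with hv
  have hv2 : v ^ 2 = u ^ 2 / r := by rw [hv, div_pow, Real.sq_sqrt hr.le, sq_abs]
  have e1 : -u ^ 2 / (8 * r) = -(v ^ 2 / 16) + -(v ^ 2 / 16) := by rw [hv2]; field_simp; ring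
  have e2 : -(16 * r)⁻¹ * u ^ 2 = -(v ^ 2 / 16) := by rw [hv2]; field_simp
  rw [e1, e2, Real.exp_add, ← mul_assoc]
  refine mul_le_mul_of_nonneg_right ?_ (Real.exp_pos _).le
  -- `(1 + v) ^ 2 ≤ 2 + 2 * v ^ 2` and `1 + v ^ 2 / 16 ≤ exp (v ^ 2 / 16)`
  rw [Real.exp_neg, ← div_eq_mul_inv, div_le_iff₀ (Real.exp_pos _)]
  have := Real.add_one_le_exp (v ^ 2 / 16)
  nlinarith [sq_nonneg (v - 1), sq_nonneg v]

theorem isKernelBound_complexHeatKernel {ρ : ℝ → ℝ} (hρ : IsHeatWeight ρ) {z : ℂ}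
    (hz : z ∈ heatCone) {a b : ℝ} (ha : 0 < a) (haz : a ≤ ‖z‖) (hzb : ‖z‖ ≤ b) :
    IsKernelBound ρ (heatMajorant a b) (complexHeatKernel z) where
  continuous := by unfold heatMajorant; fun_prop
  integrable := by
    have : 0 < b := ha.trans_le (haz.trans hzb)
    exact (integrable_exp_neg_mul_sq (by positivity)).const_mul _
  nonneg u := by unfold heatMajorant; positivity
  le ξ η hξ hη := by
    have h0 := heatCone.norm_pos hz
    have hb : 0 < b := h0.trans_le hzb
    calc ‖complexHeatKernel z ξ η‖ * √(ρ ξ)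
        ≤ (√‖z‖)⁻¹ * Real.exp (-(ξ - η) ^ 2 / (8 * ‖z‖)) * (2 * min 1 (ξ * η / ‖z‖)) * √(ρ ξ) := by
          gcongr
          exact norm_complexHeatKernel_le hz hξ hη
      _ = 2 * (√‖z‖)⁻¹ * Real.exp (-(ξ - η) ^ 2 / (8 * ‖z‖))
          * (min 1 (ξ * η / ‖z‖) * √(ρ ξ)) := by ring
      _ ≤ 2 * (√‖z‖)⁻¹ * Real.exp (-(ξ - η) ^ 2 / (8 * ‖z‖))
          * ((1 + |ξ - η| / √‖z‖) ^ 2 * √(ρ η)) := by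
          gcongr 2 * (√‖z‖)⁻¹ * Real.exp _ * ?_
          exact min_one_mul_sqrt_le hρ h0 hξ hη
      _ = 2 * (√‖z‖)⁻¹ * ((1 + |ξ - η| / √‖z‖) ^ 2 * Real.exp (-(ξ - η) ^ 2 / (8 * ‖z‖)))
          * √(ρ η) := by ring
      _ ≤ 2 * (√a)⁻¹ * (34 * Real.exp (-(16 * b)⁻¹ * (ξ - η) ^ 2)) * √(ρ η) := by
          refine mul_le_mul_of_nonneg_right (mul_le_mul (by gcongr)
            ((one_add_sq_mul_exp_le h0 _).trans ?_) (by positivity) (by positivity))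
            (Real.sqrt_nonneg _)
          gcongr
      _ = _ := by rw [heatMajorant]; ring

theorem integral_heatMajorant_self {r : ℝ} (hr : 0 < r) :
    ∫ u, heatMajorant r r u = 272 * √Real.pi := by
  unfold heatMajorant
  rw [integral_const_mul, integral_gaussian, div_inv_eq_mul,
    show Real.pi * (16 * r) = 4 ^ 2 * (Real.pi * r) by ring, Real.sqrt_mul (by positivity),
    Real.sqrt_sq (by norm_num), Real.sqrt_mul Real.pi_pos.le]
  have := Real.sqrt_pos.2 hr
  field_simp
  ring

/-! ### The holomorphic family of operators -/

/-- The first-order Taylor remainder of a bounded holomorphic function on a ball, by applying the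
Schwarz lemma twice. -/
theorem norm_taylor_remainder_le {f : ℂ → ℂ} {c z : ℂ} {R M : ℝ} (hR : 0 < R)
    (hf : DifferentiableOn ℂ f (Metric.ball c R)) (hM : ∀ w ∈ Metric.ball c R, ‖f w‖ ≤ M)
    (hz : z ∈ Metric.ball c R) :
    ‖f z - f c - (z - c) * deriv f c‖ ≤ 4 / R ^ 2 * ‖z - c‖ ^ 2 * M := by
  have hc : c ∈ Metric.ball c R := Metric.mem_ball_self hR
  have h1 : ∀ w ∈ Metric.ball c R, ‖dslope f c w‖ ≤ 2 * M / R := fun w hw =>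
    Complex.norm_dslope_le_div_of_mapsTo_ball hf (fun v hv => by
      rw [mem_closedBall_iff_norm, two_mul]
      exact (norm_sub_le _ _).trans (add_le_add (hM v hv) (hM c hc))) hw
  have h2 : ‖dslope (dslope f c) c z‖ ≤ (2 * M / R + 2 * M / R) / R :=
    Complex.norm_dslope_le_div_of_mapsTo_ball
      ((Complex.differentiableOn_dslope (Metric.ball_mem_nhds c hR)).2 hf) (fun v hv => by
      rw [mem_closedBall_iff_norm]
      exact (norm_sub_le _ _).trans (add_le_add (h1 v hv) (h1 c hc))) hz
  have e : f z - f c - (z - c) * deriv f c = (z - c) ^ 2 * dslope (dslope f c) c z := by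
    rw [← sub_smul_dslope f c z, pow_two, mul_assoc]
    have := sub_smul_dslope (dslope f c) c z
    rw [smul_eq_mul, dslope_same f c] at this
    rw [this, smul_eq_mul]
    ring
  rw [e, norm_mul, norm_pow]
  calc ‖z - c‖ ^ 2 * ‖dslope (dslope f c) c z‖ ≤ ‖z - c‖ ^ 2 * ((2 * M / R + 2 * M / R) / R) := by
        gcongr
    _ = _ := by field_simp; ring

theorem norm_deriv_le_of_ball {f : ℂ → ℂ} {c : ℂ} {R M : ℝ} (hR : 0 < R)
    (hf : DifferentiableOn ℂ f (Metric.ball c R)) (hM : ∀ w ∈ Metric.ball c R, ‖f w‖ ≤ M) :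
    ‖deriv f c‖ ≤ 2 / R * M := by
  have hc : c ∈ Metric.ball c R := Metric.mem_ball_self hR
  have := Complex.norm_deriv_le_div_of_mapsTo_ball (R₂ := 2 * M) hf (fun v hv => by
      rw [mem_closedBall_iff_norm, two_mul]
      exact (norm_sub_le _ _).trans (add_le_add (hM v hv) (hM c hc))) hR
  rwa [mul_div_right_comm] at this

/-- The derivative of `heatGaussian` with respect to the time. -/
noncomputable def heatGaussianDeriv (z : ℂ) (u : ℝ) : ℂ :=
  heatGaussian z u * ((u : ℂ) ^ 2 / (4 * z ^ 2) - 1 / (2 * z))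

theorem hasDerivAt_heatGaussian {z : ℂ} (hz : 0 < z.re) (u : ℝ) :
    HasDerivAt (fun z => heatGaussian z u) (heatGaussianDeriv z u) z := by
  have hz0 : z ≠ 0 := by rintro rfl; simp at hz
  have hpi : (Real.pi : ℂ) ≠ 0 := by exact_mod_cast Real.pi_ne_zero
  have h4 : (4 * Real.pi * z : ℂ) ≠ 0 := by simp [hz0]
  have h1 : HasDerivAt (fun z : ℂ => 4 * Real.pi * z) (4 * Real.pi) z := by
    simpa using (hasDerivAt_id z).const_mul (4 * Real.pi : ℂ)
  have h2 := h1.cpow_const (c := -(1 / 2)) (Or.inl (re_four_pi_mul_pos hz))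
  have h3 : HasDerivAt (fun z : ℂ => -(u : ℂ) ^ 2 / (4 * z)) ((u : ℂ) ^ 2 / (4 * z ^ 2)) z := by
    have h := (((hasDerivAt_id z).const_mul (4 : ℂ)).inv (by simp [hz0])).const_mul (-(u : ℂ) ^ 2)
    simp only [id] at h
    refine h.congr_deriv ?_
    field_simp
  refine (h2.mul h3.cexp).congr_deriv ?_
  rw [heatGaussianDeriv, heatGaussian, Complex.cpow_sub _ _ h4, Complex.cpow_one]
  field_simp
  ring

/-- The derivative of the Dirichlet heat kernel with respect to the time. -/
noncomputable def complexHeatKernelDeriv (z : ℂ) (ξ η : ℝ) : ℂ :=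
  heatGaussianDeriv z (ξ - η) - heatGaussianDeriv z (ξ + η)

theorem hasDerivAt_complexHeatKernel {z : ℂ} (hz : 0 < z.re) (ξ η : ℝ) :
    HasDerivAt (fun z => complexHeatKernel z ξ η) (complexHeatKernelDeriv z ξ η) z :=
  (hasDerivAt_heatGaussian hz _).sub (hasDerivAt_heatGaussian hz _)

theorem measurable_complexHeatKernelDeriv (z : ℂ) :
    Measurable (Function.uncurry (complexHeatKernelDeriv z)) := by
  have := continuous_heatGaussian z
  unfold complexHeatKernelDeriv heatGaussianDeriv Function.uncurry
  exact Continuous.measurable (by fun_prop)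

open Classical in
/-- The Dirichlet heat semigroup `e^{zA}` on `L²(ρ dξ)` at complex times `z` in `heatCone`; outside
the cone, in particular at `z = 0`, it is the identity. -/
noncomputable def heatOp (ρ : ℝ → ℝ) (z : ℂ) : WeightedL2C ρ →L[ℂ] WeightedL2C ρ :=
  if h : z ∈ heatCone ∧ ∃ T, HasKernel ρ T (complexHeatKernel z) then h.2.choose
  else ContinuousLinearMap.id ℂ _

theorem heatOp_zero (ρ : ℝ → ℝ) : heatOp ρ 0 = ContinuousLinearMap.id ℂ _ := by
  rw [heatOp, dif_neg]
  rintro ⟨h, -⟩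
  exact heatCone.ne_zero h rfl

theorem hasKernel_heatOp {ρ : ℝ → ℝ} (hρ : IsHeatWeight ρ) {z : ℂ} (hz : z ∈ heatCone) :
    HasKernel ρ (heatOp ρ z) (complexHeatKernel z) := by
  have h : z ∈ heatCone ∧ ∃ T, HasKernel ρ T (complexHeatKernel z) :=
    ⟨hz, (isKernelBound_complexHeatKernel hρ hz (heatCone.norm_pos hz) le_rfl le_rfl).exists_hasKernel
      hρ (measurable_complexHeatKernel z)⟩
  rw [heatOp, dif_pos h]
  exact h.2.choose_spec

theorem norm_heatOp_le {ρ : ℝ → ℝ} (hρ : IsHeatWeight ρ) {z : ℂ} (hz : z ∈ heatCone) :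
    ‖heatOp ρ z‖ ≤ 272 * √Real.pi := by
  have h0 := heatCone.norm_pos hz
  rw [← integral_heatMajorant_self h0]
  exact (hasKernel_heatOp hρ hz).norm_le hρ
    (isKernelBound_complexHeatKernel hρ hz h0 le_rfl le_rfl) (measurable_complexHeatKernel z)

theorem heatOp_add {ρ : ℝ → ℝ} (hρ : IsHeatWeight ρ) {z w : ℂ} (hz : z ∈ heatCone)
    (hw : w ∈ heatCone) : heatOp ρ (z + w) = (heatOp ρ z).comp (heatOp ρ w) := by
  refine (hasKernel_heatOp hρ (heatCone.add hz hw)).ext ?_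
  refine ((hasKernel_heatOp hρ hz).comp hρ (hasKernel_heatOp hρ hw)
    (isKernelBound_complexHeatKernel hρ hz (heatCone.norm_pos hz) le_rfl le_rfl)
    (isKernelBound_complexHeatKernel hρ hw (heatCone.norm_pos hw) le_rfl le_rfl)
    (measurable_complexHeatKernel z) (measurable_complexHeatKernel w)).congr fun ξ η _ _ => ?_
  exact integral_complexHeatKernel_mul (heatCone.re_pos hz) (heatCone.re_pos hw) ξ η

theorem IsKernelBound.of_le_const_mul {ρ Φ : ℝ → ℝ} {K : ℝ → ℝ → ℂ} {c : ℝ} (hc : 0 ≤ c)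
    (hΦ : Continuous Φ) (hi : Integrable Φ) (h0 : ∀ u, 0 ≤ Φ u)
    (h : ∀ ξ η, 0 < ξ → 0 < η → ‖K ξ η‖ * √(ρ ξ) ≤ c * (Φ (ξ - η) * √(ρ η))) :
    IsKernelBound ρ (fun u => c * Φ u) K where
  continuous := by fun_prop
  integrable := hi.const_mul c
  nonneg u := mul_nonneg hc (h0 u)
  le ξ η hξ hη := by rw [mul_assoc]; exact h ξ η hξ hη

/-- Holomorphy in the operator norm: the Cauchy estimates hold for the kernels pointwise, and a
pointwise majorant of a kernel controls the norm of its operator. -/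
theorem differentiableAt_heatOp {ρ : ℝ → ℝ} (hρ : IsHeatWeight ρ) {c : ℂ} (hc : c ∈ heatCone) :
    DifferentiableAt ℂ (heatOp ρ) c := by
  have h0 := heatCone.norm_pos hc
  obtain ⟨R₀, hR₀, hsub₀⟩ := Metric.isOpen_iff.1 isOpen_heatCone c hc
  set R := min R₀ (‖c‖ / 2) with hRdef
  have hR : 0 < R := lt_min hR₀ (by positivity)
  have hsub : Metric.ball c R ⊆ heatCone := (Metric.ball_subset_ball (min_le_left _ _)).trans hsub₀
  set Φ := heatMajorant (‖c‖ / 2) (2 * ‖c‖) with hΦ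
  have hb : ∀ w ∈ Metric.ball c R, IsKernelBound ρ Φ (complexHeatKernel w) := fun w hw => by
    have h1 : ‖w - c‖ < ‖c‖ / 2 := (mem_ball_iff_norm.1 hw).trans_le (min_le_right _ _)
    have h2 := norm_sub_norm_le c w
    have h3 := norm_sub_norm_le w c
    rw [norm_sub_rev] at h2
    exact isKernelBound_complexHeatKernel hρ (hsub hw) (by positivity) (by linarith) (by linarith)
  have hbc := hb c (Metric.mem_ball_self hR)
  have hdiff : ∀ ξ η, DifferentiableOn ℂ (fun w => complexHeatKernel w ξ η) (Metric.ball c R) :=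
    fun ξ η w hw => (hasDerivAt_complexHeatKernel
      (heatCone.re_pos (hsub hw)) ξ η).differentiableAt.differentiableWithinAt
  have hsq : ∀ ξ, 0 < ξ → 0 < √(ρ ξ) := fun ξ hξ => Real.sqrt_pos.2 (hρ.pos ξ hξ)
  have hM : ∀ ξ η, 0 < ξ → 0 < η → ∀ w ∈ Metric.ball c R,
      ‖complexHeatKernel w ξ η‖ ≤ Φ (ξ - η) * √(ρ η) / √(ρ ξ) := fun ξ η hξ hη w hw => by
    rw [le_div_iff₀ (hsq ξ hξ)]
    exact (hb w hw).le ξ η hξ hη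
  have hbd : IsKernelBound ρ (fun u => 2 / R * Φ u) (complexHeatKernelDeriv c) := by
    refine .of_le_const_mul (by positivity) hbc.continuous hbc.integrable hbc.nonneg
      fun ξ η hξ hη => ?_
    have := norm_deriv_le_of_ball hR (hdiff ξ η) (hM ξ η hξ hη)
    rw [(hasDerivAt_complexHeatKernel (heatCone.re_pos hc) ξ η).deriv, ← mul_div_assoc,
      le_div_iff₀ (hsq ξ hξ)] at this
    exact this
  obtain ⟨D, hD⟩ := hbd.exists_hasKernel hρ (measurable_complexHeatKernelDeriv c)
  have hbound : ∀ w ∈ Metric.ball c R, ‖heatOp ρ w - heatOp ρ c - (w - c) • D‖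
      ≤ 4 / R ^ 2 * (∫ u, Φ u) * ‖w - c‖ ^ 2 := fun w hw => by
    have hk := ((hasKernel_heatOp hρ (hsub hw)).sub (hasKernel_heatOp hρ hc)).sub
      (hD.smul (w - c))
    have hkb : IsKernelBound ρ (fun u => 4 / R ^ 2 * ‖w - c‖ ^ 2 * Φ u) (fun ξ η =>
        complexHeatKernel w ξ η - complexHeatKernel c ξ η
          - (w - c) * complexHeatKernelDeriv c ξ η) := by
      refine .of_le_const_mul (by positivity) hbc.continuous hbc.integrable hbc.nonneg
        fun ξ η hξ hη => ?_
      have := norm_taylor_remainder_le hR (hdiff ξ η) (hM ξ η hξ hη) hw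
      rw [(hasDerivAt_complexHeatKernel (heatCone.re_pos hc) ξ η).deriv, ← mul_div_assoc,
        le_div_iff₀ (hsq ξ hξ)] at this
      exact this
    have hm1 : Measurable fun p : ℝ × ℝ => complexHeatKernel w p.1 p.2 :=
      measurable_complexHeatKernel w
    have hm2 : Measurable fun p : ℝ × ℝ => complexHeatKernel c p.1 p.2 :=
      measurable_complexHeatKernel c
    have hm3 : Measurable fun p : ℝ × ℝ => complexHeatKernelDeriv c p.1 p.2 :=
      measurable_complexHeatKernelDeriv c
    refine (hk.norm_le hρ hkb (by unfold Function.uncurry; fun_prop)).trans_eq ?_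
    rw [integral_const_mul]
    ring
  have hder : HasDerivAt (heatOp ρ) D c := by
    rw [hasDerivAt_iff_isLittleO]
    refine Asymptotics.IsBigO.trans_isLittleO (g := fun w => ‖w - c‖ ^ 2) ?_
      (Asymptotics.isLittleO_pow_sub_sub c one_lt_two)
    refine Asymptotics.IsBigO.of_bound (4 / R ^ 2 * ∫ u, Φ u) ?_
    filter_upwards [Metric.ball_mem_nhds c hR] with w hw
    simpa using hbound w hw
  exact hder.differentiableAt

/-! ### Strong continuity at time zero -/

theorem isClosed_setOf_tendsto_of_bound {ι 𝕜 E : Type*} [RCLike 𝕜] [NormedAddCommGroup E]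
    [NormedSpace 𝕜 E] {l : Filter ι} {T : ι → E →L[𝕜] E} {M : ℝ} (hM : ∀ᶠ i in l, ‖T i‖ ≤ M) :
    IsClosed {x | Tendsto (fun i => T i x) l (𝓝 x)} := by
  refine isClosed_of_closure_subset fun x hx => ?_
  rw [mem_ofPred_eq, Metric.tendsto_nhds]
  intro ε hε
  have hM0 : 0 < |M| + 1 := by positivity
  obtain ⟨y, hy, hxy⟩ := Metric.mem_closure_iff.1 hx (ε / (2 * (|M| + 1))) (by positivity)
  have hy' := Metric.tendsto_nhds.1 hy (ε / 2) (by positivity)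
  filter_upwards [hM, hy'] with i h1 h2
  rw [dist_eq_norm] at *
  have h3 : ‖T i (x - y)‖ ≤ |M| * ‖x - y‖ :=
    (T i).le_of_opNorm_le (h1.trans (le_abs_self M)) _
  have e : T i x - x = T i (x - y) + (T i y - y) - (x - y) := by rw [map_sub]; abel
  rw [e]
  have h4 : (|M| + 1) * ‖x - y‖ < ε / 2 := by
    rw [lt_div_iff₀ (by positivity)] at hxy ⊢
    linarith
  calc _ ≤ ‖T i (x - y)‖ + ‖T i y - y‖ + ‖x - y‖ :=
        (norm_sub_le _ _).trans (add_le_add_left (norm_add_le _ _) _)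
    _ < ε := by linarith

theorem IsHeatWeight.isLocallyFiniteMeasure {ρ : ℝ → ℝ} (hρ : IsHeatWeight ρ) :
    IsLocallyFiniteMeasure (weightedMeasure ρ) := by
  have : IsLocallyFiniteMeasure halfLineMeasure := by unfold halfLineMeasure; infer_instance
  exact .withDensity_ofReal hρ.continuous

theorem IsHeatWeight.memLp_of_hasCompactSupport {ρ : ℝ → ℝ} (hρ : IsHeatWeight ρ) {E : Type*}
    [NormedAddCommGroup E] {g : ℝ → E} (hg : Continuous g) (hgc : HasCompactSupport g) :
    MemLp g 2 (weightedMeasure ρ) :=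
  have := hρ.isLocallyFiniteMeasure
  hg.memLp_of_hasCompactSupport hgc

/-- Continuous functions with compact support in `ℝ`, restricted to the half-line, are dense in
`L²(ρ dξ)`. They need not vanish at the boundary point `0`. -/
theorem IsHeatWeight.mem_of_isClosed {ρ : ℝ → ℝ} (hρ : IsHeatWeight ρ) {E : Type*}
    [NormedAddCommGroup E] [NormedSpace ℝ E] {V : Set (Lp E 2 (weightedMeasure ρ))}
    (hV : IsClosed V)
    (h : ∀ g : ℝ → E, Continuous g → HasCompactSupport g →
      ∀ hg : MemLp g 2 (weightedMeasure ρ), hg.toLp g ∈ V)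
    (f : Lp E 2 (weightedMeasure ρ)) : f ∈ V := by
  have := hρ.isLocallyFiniteMeasure
  rw [← hV.closure_eq, EMetric.mem_closure_iff]
  intro ε hε
  obtain ⟨g, hgc, hfg, hg, hgL⟩ := (Lp.memLp f).exists_hasCompactSupport_eLpNorm_sub_le
    (by norm_num) (ENNReal.half_pos hε.ne').ne'
  refine ⟨hgL.toLp g, h g hg hgc hgL, ?_⟩
  rw [Lp.edist_def, eLpNorm_congr_ae ((ae_eq_refl _).sub hgL.coeFn_toLp)]
  rcases eq_or_ne ε ∞ with rfl | hε'
  · exact ((Lp.memLp f).sub hgL).2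
  · exact hfg.trans_lt (ENNReal.half_lt_self hε.ne' hε')

theorem one_mem_heatCone : (1 : ℂ) ∈ heatCone := by
  simpa using ofReal_mem_heatCone one_pos

theorem norm_heatGaussian_one_le (u : ℝ) : ‖heatGaussian 1 u‖ ≤ Real.exp (-u ^ 2 / 8) := by
  simpa using norm_heatGaussian_le one_mem_heatCone u

theorem integral_heatGaussian_one : ∫ u, heatGaussian 1 u = 1 := by
  have e : ∀ u, heatGaussian 1 u
      = ((1 / √(4 * Real.pi) * Real.exp (-(1 / 4) * u ^ 2) : ℝ) : ℂ) := fun u => by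
    have := heatGaussian_ofReal one_pos u
    rw [Complex.ofReal_one] at this
    rw [this]
    congr 2
    · ring_nf
    · ring_nf
  simp only [e]
  rw [integral_complex_ofReal, integral_const_mul, integral_gaussian,
    show Real.pi / (1 / 4) = 4 * Real.pi by ring]
  have : 0 < √(4 * Real.pi) := Real.sqrt_pos.2 (by positivity)
  rw [one_div_mul_cancel this.ne', Complex.ofReal_one]

theorem heatGaussian_sqrt_mul {s : ℝ} (hs : 0 < s) (u : ℝ) :
    heatGaussian s (√s * u) = (((√s)⁻¹ : ℝ) : ℂ) * heatGaussian 1 u := by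
  have h1 := heatGaussian_ofReal one_pos u
  rw [Complex.ofReal_one] at h1
  rw [heatGaussian_ofReal hs, h1, ← Complex.ofReal_mul]
  congr 1
  have h2 : -(√s * u) ^ 2 / (4 * s) = -u ^ 2 / (4 * 1) := by
    rw [mul_pow, Real.sq_sqrt hs.le]
    field_simp
  rw [h2, Real.sqrt_mul (by positivity), mul_one, ← mul_assoc]
  congr 1
  field_simp

/-- The odd extension of a function from the half-line to the line. -/
noncomputable def oddExtension (g : ℝ → ℂ) (x : ℝ) : ℂ := if 0 < x then g x else -g (-x)

theorem measurable_oddExtension {g : ℝ → ℂ} (hg : Continuous g) : Measurable (oddExtension g) :=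
  Measurable.ite measurableSet_Ioi hg.measurable (by fun_prop)

theorem norm_oddExtension_le {g : ℝ → ℂ} {b : ℝ → ℝ} (h : ∀ x, ‖g x‖ ≤ b |x|) (x : ℝ) :
    ‖oddExtension g x‖ ≤ b |x| := by
  unfold oddExtension
  split_ifs
  · exact h x
  · rw [norm_neg, ← abs_neg]
    exact h _

/-- The reflection principle: the Dirichlet heat semigroup is the heat semigroup of the line applied
to odd functions. After rescaling, the time enters only through the argument of the function. -/
theorem integral_complexHeatKernel_eq {g : ℝ → ℂ} (hg : Continuous g)
    (hgc : HasCompactSupport g) {s : ℝ} (hs : 0 < s) (ξ : ℝ) :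
    ∫ η in Ioi 0, complexHeatKernel s ξ η * g η
      = ∫ u, heatGaussian 1 u * oddExtension g (ξ - √s * u) := by
  have hc := continuous_heatGaussian s
  have hi : ∀ h : ℝ → ℝ, Continuous h →
      Integrable fun η => heatGaussian s (h η) * g η := fun h hh =>
    Continuous.integrable_of_hasCompactSupport (by fun_prop) hgc.mul_left
  have hi' : Integrable fun η => heatGaussian s (ξ - η) * -g (-η) := by
    have := (hi (fun η => ξ + η) (by fun_prop)).comp_neg.neg
    refine this.congr (ae_of_all _ fun η => ?_)
    simp [sub_eq_add_neg]
  have e1 : EqOn (fun η => heatGaussian s (ξ - η) * oddExtension g η)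
      (fun η => heatGaussian s (ξ - η) * g η) (Ioi 0) := fun η hη => by
    simp only [oddExtension, if_pos (mem_Ioi.1 hη)]
  have e2 : EqOn (fun η => heatGaussian s (ξ - η) * oddExtension g η)
      (fun η => heatGaussian s (ξ - η) * -g (-η)) (Iic 0) := fun η hη => by
    simp only [oddExtension, if_neg (not_lt.2 (mem_Iic.1 hη))]
  have hsplit := intervalIntegral.integral_Iic_add_Ioi (b := 0)
    (hi'.integrableOn.congr_fun e2.symm measurableSet_Iic)
    ((hi (fun η => ξ - η) (by fun_prop)).integrableOn.congr_fun e1.symm measurableSet_Ioi)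
  rw [setIntegral_congr_fun measurableSet_Iic e2, setIntegral_congr_fun measurableSet_Ioi e1]
    at hsplit
  have hneg := integral_comp_neg_Ioi 0 fun η => heatGaussian s (ξ - η) * -g (-η)
  simp only [neg_zero, neg_neg, sub_neg_eq_add] at hneg
  have hleft : ∫ η in Ioi 0, complexHeatKernel s ξ η * g η
      = ∫ η, heatGaussian s (ξ - η) * oddExtension g η := by
    rw [← hsplit, ← hneg, ← integral_add
      ((hi (fun η => ξ + η) (by fun_prop)).neg.integrableOn.congr_fun
        (fun η _ => by simp) measurableSet_Ioi)
      (hi (fun η => ξ - η) (by fun_prop)).integrableOn]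
    refine integral_congr_ae (ae_of_all _ fun η => ?_)
    simp only [complexHeatKernel]
    ring
  have hs' : 0 < √s := Real.sqrt_pos.2 hs
  have hsub := integral_sub_left_eq_self
    (fun v => heatGaussian s v * oddExtension g (ξ - v)) volume ξ
  have hscale := Measure.integral_comp_mul_left
    (fun v => heatGaussian s v * oddExtension g (ξ - v)) (√s)
  simp only [sub_sub_cancel] at hsub
  simp only [heatGaussian_sqrt_mul hs, mul_assoc] at hscale
  rw [integral_const_mul, abs_of_pos (inv_pos.2 hs'), Complex.real_smul] at hscale
  rw [hleft, hsub]
  exact (mul_left_cancel₀ (by simpa using hs'.ne') hscale).symm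

theorem exists_norm_le_div_one_add_sq {g : ℝ → ℂ} (hg : Continuous g)
    (hgc : HasCompactSupport g) : ∃ M, 0 ≤ M ∧ ∀ x, ‖g x‖ ≤ M / (1 + |x|) ^ 2 := by
  obtain ⟨M, hM⟩ := HasCompactSupport.exists_bound_of_continuous
    (f := fun x => (((1 + |x|) ^ 2 : ℝ) : ℂ) * g x) hgc.mul_left (by fun_prop)
  refine ⟨M, (norm_nonneg _).trans (hM 0), fun x => ?_⟩
  have := hM x
  rw [norm_mul, Complex.norm_real, Real.norm_of_nonneg (by positivity)] at this
  rwa [le_div_iff₀ (by positivity), mul_comm]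

theorem tendsto_integral_complexHeatKernel {g : ℝ → ℂ} (hg : Continuous g)
    (hgc : HasCompactSupport g) {ξ : ℝ} (hξ : 0 < ξ) :
    Tendsto (fun s : ℝ => ∫ η in Ioi 0, complexHeatKernel s ξ η * g η) (𝓝[>] 0) (𝓝 (g ξ)) := by
  obtain ⟨M, hM⟩ := hgc.exists_bound_of_continuous hg
  have hc := continuous_heatGaussian 1
  have hmo := measurable_oddExtension hg
  have key : Tendsto (fun s : ℝ => ∫ u, heatGaussian 1 u * oddExtension g (ξ - √s * u)) (𝓝[>] 0)
      (𝓝 (∫ u, heatGaussian 1 u * g ξ)) := by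
    refine tendsto_integral_filter_of_dominated_convergence
      (fun u => Real.exp (-(1 / 8) * u ^ 2) * M) (Eventually.of_forall fun s => ?_)
      (Eventually.of_forall fun s => ae_of_all _ fun u => ?_)
      ((integrable_exp_neg_mul_sq (by norm_num)).mul_const M) (ae_of_all _ fun u => ?_)
    · exact Measurable.aestronglyMeasurable (by fun_prop)
    · rw [norm_mul]
      refine mul_le_mul ((norm_heatGaussian_one_le u).trans_eq (by ring_nf))
        (norm_oddExtension_le (b := fun _ => M) hM _) (norm_nonneg _) (Real.exp_pos _).le
    · refine Tendsto.const_mul _ ?_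
      have h1 : ContinuousAt (oddExtension g) ξ := by
        refine hg.continuousAt.congr ?_
        filter_upwards [Ioi_mem_nhds hξ] with x hx
        simp only [oddExtension, if_pos (mem_Ioi.1 hx)]
      have h2 : oddExtension g ξ = g ξ := by simp only [oddExtension, if_pos hξ]
      have h3 : Tendsto (fun s : ℝ => ξ - √s * u) (𝓝[>] 0) (𝓝 ξ) := by
        have : Continuous fun s : ℝ => ξ - √s * u := by fun_prop
        simpa using (this.tendsto 0).mono_left nhdsWithin_le_nhds
      have := h1.tendsto.comp h3
      rwa [h2] at this
  rw [integral_mul_const, integral_heatGaussian_one, one_mul] at key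
  refine key.congr' ?_
  filter_upwards [self_mem_nhdsWithin] with s hs
  exact (integral_complexHeatKernel_eq hg hgc hs ξ).symm

theorem integrable_exp_mul_one_add_sq :
    Integrable fun u : ℝ => Real.exp (-u ^ 2 / 8) * (1 + |u|) ^ 2 := by
  refine ((integrable_exp_neg_mul_sq (b := (16 * 1)⁻¹) (by norm_num)).const_mul 34).mono'
    (Continuous.aestronglyMeasurable (by fun_prop)) (ae_of_all _ fun u => ?_)
  rw [Real.norm_of_nonneg (by positivity)]
  have := one_add_sq_mul_exp_le one_pos u
  rw [Real.sqrt_one, div_one, mul_one] at this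
  linarith

/-- A majorant in `L²(ρ dξ)` of the semigroup applied to a test function, uniform for times in
`(0, 1]`. -/
theorem exists_norm_integral_complexHeatKernel_le {g : ℝ → ℂ} (hg : Continuous g)
    (hgc : HasCompactSupport g) : ∃ C, 0 ≤ C ∧ ∀ s ξ : ℝ, 0 < s → s ≤ 1 → 0 < ξ →
      ‖(∫ η in Ioi 0, complexHeatKernel s ξ η * g η) - g ξ‖ ≤ C / (1 + ξ) ^ 2 := by
  obtain ⟨M, hM0, hM⟩ := exists_norm_le_div_one_add_sq hg hgc
  refine ⟨(∫ u, Real.exp (-u ^ 2 / 8) * (1 + |u|) ^ 2) * M + M,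
    add_nonneg (mul_nonneg (integral_nonneg fun u => by positivity) hM0) hM0,
    fun s ξ hs hs1 hξ => ?_⟩
  rw [add_div]
  have hg' := hM ξ
  rw [abs_of_pos hξ] at hg'
  refine (norm_sub_le _ _).trans (add_le_add ?_ hg')
  rw [integral_complexHeatKernel_eq hg hgc hs, mul_div_assoc, ← integral_mul_const]
  refine norm_integral_le_of_norm_le (integrable_exp_mul_one_add_sq.mul_const _)
    (ae_of_all _ fun u => ?_)
  rw [norm_mul, mul_assoc]
  refine mul_le_mul (norm_heatGaussian_one_le u) ?_ (norm_nonneg _) (Real.exp_pos _).le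
  refine (norm_oddExtension_le (b := fun x => M / (1 + x) ^ 2) hM _).trans ?_
  rw [← mul_div_assoc, div_le_div_iff₀ (by positivity) (by positivity)]
  have h1 : √s * |u| ≤ |u| := mul_le_of_le_one_left (abs_nonneg u) (Real.sqrt_le_one.2 hs1)
  have h2 : ξ ≤ |ξ - √s * u| + √s * |u| := by
    have := le_abs_self (ξ - √s * u)
    have h := mul_le_mul_of_nonneg_left (le_abs_self u) (Real.sqrt_nonneg s)
    linarith
  have h3 : 1 + ξ ≤ (1 + |u|) * (1 + |ξ - √s * u|) := by
    nlinarith [mul_nonneg (abs_nonneg u) (abs_nonneg (ξ - √s * u))]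
  calc M * (1 + ξ) ^ 2 ≤ M * ((1 + |u|) * (1 + |ξ - √s * u|)) ^ 2 := by gcongr
    _ = _ := by ring

theorem IsHeatWeight.le_mul_one_add_sq {ρ : ℝ → ℝ} (hρ : IsHeatWeight ρ) {ξ : ℝ} (hξ : 0 < ξ) :
    ρ ξ ≤ ρ 1 * (1 + ξ) ^ 2 := by
  have h1 := hρ.pos 1 one_pos
  rcases le_total ξ 1 with h | h
  · exact (hρ.mono ξ 1 hξ h).trans (le_mul_of_one_le_right h1.le (by nlinarith))
  · have := hρ.quad 1 ξ one_pos h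
    nlinarith

theorem IsHeatWeight.lintegral_majorant_ne_top {ρ : ℝ → ℝ} (hρ : IsHeatWeight ρ) (C : ℝ) :
    ∫⁻ ξ, ENNReal.ofReal (C / (1 + ξ) ^ 2) ^ 2 ∂(weightedMeasure ρ) ≠ ∞ := by
  have hint : Integrable fun ξ : ℝ => C ^ 2 * ρ 1 * (1 + ‖ξ‖) ^ (-2 : ℝ) :=
    (integrable_one_add_norm (by simp)).const_mul _
  refine ne_top_of_le_ne_top hint.integrableOn.lintegral_lt_top.ne
    ((lintegral_withDensity_le_lintegral_mul _ hρ.measurable.ennreal_ofReal _).trans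
      (setLIntegral_mono' (s := Ioi 0) measurableSet_Ioi fun ξ hξ => ?_))
  have hξ' : 0 < ξ := hξ
  have h1 := hρ.pos 1 one_pos
  have h2 := hρ.le_mul_one_add_sq hξ'
  rcases le_total 0 C with hC | hC
  · rw [Pi.mul_apply, ← ENNReal.ofReal_pow (by positivity),
      ← ENNReal.ofReal_mul (hρ.pos ξ hξ').le]
    refine ENNReal.ofReal_le_ofReal ?_
    rw [Real.norm_of_nonneg hξ'.le, Real.rpow_neg (by positivity), Real.rpow_two]
    calc ρ ξ * (C / (1 + ξ) ^ 2) ^ 2 ≤ ρ 1 * (1 + ξ) ^ 2 * (C / (1 + ξ) ^ 2) ^ 2 := by gcongr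
      _ = _ := by field_simp
  · rw [Pi.mul_apply, ENNReal.ofReal_of_nonpos (div_nonpos_of_nonpos_of_nonneg hC (by positivity))]
    simp

/-- Strong continuity along positive times on test functions, by dominated convergence. -/
theorem tendsto_heatOp_toLp {ρ : ℝ → ℝ} (hρ : IsHeatWeight ρ) {g : ℝ → ℂ} (hg : Continuous g)
    (hgc : HasCompactSupport g) (hgL : MemLp g 2 (weightedMeasure ρ)) :
    Tendsto (fun s : ℝ => heatOp ρ s (hgL.toLp g)) (𝓝[>] 0) (𝓝 (hgL.toLp g)) := by
  obtain ⟨C, hC0, hC⟩ := exists_norm_integral_complexHeatKernel_le hg hgc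
  have hpos : ∀ᵐ ξ ∂(weightedMeasure ρ), 0 < ξ := ae_weightedMeasure_of_forall_pos fun _ h => h
  have hgm := hg.measurable
  have key : Tendsto (fun s : ℝ => ∫⁻ ξ, ‖(∫ η in Ioi 0, complexHeatKernel s ξ η * g η) - g ξ‖ₑ ^ 2
      ∂(weightedMeasure ρ)) (𝓝[>] 0) (𝓝 (∫⁻ _, 0 ∂(weightedMeasure ρ))) := by
    refine tendsto_lintegral_filter_of_dominated_convergence
      (fun ξ => ENNReal.ofReal (C / (1 + ξ) ^ 2) ^ 2) (Eventually.of_forall fun s => ?_) ?_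
      (hρ.lintegral_majorant_ne_top C) ?_
    · have hm : Measurable fun p : ℝ × ℝ => complexHeatKernel s p.1 p.2 :=
        measurable_complexHeatKernel s
      have : Measurable fun ξ => ∫ η in Ioi 0, complexHeatKernel s ξ η * g η :=
        (StronglyMeasurable.integral_prod_right'
          (f := fun p : ℝ × ℝ => complexHeatKernel s p.1 p.2 * g p.2) (by fun_prop)).measurable
      fun_prop
    · filter_upwards [Ioc_mem_nhdsGT one_pos] with s hs
      filter_upwards [hpos] with ξ hξ
      refine pow_le_pow_left₀ zero_le ?_ 2
      rw [← ofReal_norm]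
      exact ENNReal.ofReal_le_ofReal (hC s ξ hs.1 hs.2 hξ)
    · filter_upwards [hpos] with ξ hξ
      have h1 := ((tendsto_integral_complexHeatKernel hg hgc hξ).sub_const (g ξ)).enorm
      simpa [Function.comp_def] using ((ENNReal.continuous_pow 2).tendsto _).comp h1
  rw [lintegral_zero] at key
  rw [Lp.tendsto_Lp_iff_tendsto_eLpNorm']
  have h2 := (ENNReal.continuous_rpow_const (y := 1 / 2)).tendsto 0 |>.comp key
  rw [ENNReal.zero_rpow_of_pos (by norm_num)] at h2
  refine h2.congr' ?_
  filter_upwards [self_mem_nhdsWithin] with s hs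
  have e : ⇑(heatOp ρ s (hgL.toLp g)) - ⇑(hgL.toLp g) =ᵐ[weightedMeasure ρ]
      fun ξ => (∫ η in Ioi 0, complexHeatKernel s ξ η * g η) - g ξ := by
    filter_upwards [hasKernel_heatOp hρ (ofReal_mem_heatCone hs) (hgL.toLp g), hgL.coeFn_toLp]
      with ξ h1 h2
    rw [Pi.sub_apply, h1.2, h2]
    congr 1
    refine integral_congr_ae ?_
    filter_upwards [hρ.ae_halfLine hgL.coeFn_toLp] with η h
    rw [h]
  rw [Function.comp_apply, eLpNorm_congr_ae e, ← eLpNorm_two_sq, ← ENNReal.rpow_two,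
    ← ENNReal.rpow_mul]
  norm_num

/-- Strong continuity at `0` inside the cone. By norm continuity at positive times `s` it holds on
the ranges of the operators `heatOp ρ s`, and these are dense. -/
theorem tendsto_heatOp_zero {ρ : ℝ → ℝ} (hρ : IsHeatWeight ρ) (x : WeightedL2C ρ) :
    Tendsto (fun z => heatOp ρ z x) (𝓝[heatCone] 0) (𝓝 x) := by
  have hcl : IsClosed {x | Tendsto (fun z => heatOp ρ z x) (𝓝[heatCone] 0) (𝓝 x)} :=
    isClosed_setOf_tendsto_of_bound (M := 272 * √Real.pi)
      (by filter_upwards [self_mem_nhdsWithin] with z hz using norm_heatOp_le hρ hz)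
  have hrange : ∀ s : ℝ, 0 < s → ∀ y, heatOp ρ s y
      ∈ {x | Tendsto (fun z => heatOp ρ z x) (𝓝[heatCone] 0) (𝓝 x)} := fun s hs y => by
    have hs' := ofReal_mem_heatCone hs
    have h1 : Tendsto (fun z : ℂ => z + s) (𝓝[heatCone] 0) (𝓝 (s : ℂ)) := by
      have : Continuous fun z : ℂ => z + s := by fun_prop
      simpa using (this.tendsto 0).mono_left nhdsWithin_le_nhds
    have h2 := ((ContinuousLinearMap.apply ℂ (WeightedL2C ρ) y).continuous.tendsto _).comp
      ((differentiableAt_heatOp hρ hs').continuousAt.tendsto.comp h1)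
    refine h2.congr' ?_
    filter_upwards [self_mem_nhdsWithin] with z hz
    rw [Function.comp_apply, Function.comp_apply, ContinuousLinearMap.apply_apply,
      heatOp_add hρ hz hs', ContinuousLinearMap.comp_apply]
  refine hρ.mem_of_isClosed hcl (fun g hg hgc hgL => ?_) x
  refine hcl.mem_of_tendsto (tendsto_heatOp_toLp hρ hg hgc hgL) ?_
  filter_upwards [self_mem_nhdsWithin] with s hs using hrange s hs _

/-! ### Generators of semigroups -/

/-- Every `C₀` semigroup has an infinitesimal generator. -/
theorem C0Semigroup.exists_isGenerator {𝕜 E : Type*} [RCLike 𝕜] [NormedAddCommGroup E]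
    [NormedSpace 𝕜 E] (S : C0Semigroup 𝕜 E) : ∃ A : E →ₗ.[𝕜] E, S.IsGenerator A := by
  let q : E → ℝ≥0 → E := fun x t => (((t : ℝ)⁻¹ : ℝ) : 𝕜) • (S.op t x - x)
  have hadd : ∀ {x x' y y'}, Tendsto (q x) (𝓝[>] 0) (𝓝 y) → Tendsto (q x') (𝓝[>] 0) (𝓝 y') →
      Tendsto (q (x + x')) (𝓝[>] 0) (𝓝 (y + y')) := fun {x x' y y'} h h' => by
    refine (h.add h').congr fun t => ?_
    simp only [q, map_add, ← smul_add]
    congr 1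
    abel
  have hsmul : ∀ {x y} (c : 𝕜), Tendsto (q x) (𝓝[>] 0) (𝓝 y) →
      Tendsto (q (c • x)) (𝓝[>] 0) (𝓝 (c • y)) := fun {x y} c h => by
    refine (h.const_smul c).congr fun t => ?_
    simp only [q, map_smul, ← smul_sub]
    rw [smul_comm]
  let D : Submodule 𝕜 E :=
    { carrier := {x | ∃ y, Tendsto (q x) (𝓝[>] 0) (𝓝 y)}
      add_mem' := fun ⟨_, h⟩ ⟨_, h'⟩ => ⟨_, hadd h h'⟩
      zero_mem' := ⟨0, by simp [q]⟩
      smul_mem' := fun c _ ⟨_, h⟩ => ⟨_, hsmul c h⟩ }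
  have hD : ∀ x : D, ∃ y, Tendsto (q x) (𝓝[>] 0) (𝓝 y) := fun x => x.2
  choose F hF using hD
  exact ⟨⟨D, { toFun := F
               map_add' := fun x x' => tendsto_nhds_unique (hF (x + x')) (hadd (hF x) (hF x'))
               map_smul' := fun c x => tendsto_nhds_unique (hF (c • x)) (hsmul c (hF x)) }⟩,
    fun x => Iff.rfl, hF⟩

/-! ### The two weights -/

theorem isHeatWeight_rpow {θ : ℝ} (hθ0 : 0 < θ) (hθ1 : θ < 1) :
    IsHeatWeight fun ξ : ℝ => ξ ^ (1 + θ) where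
  continuous := Real.continuous_rpow_const (by linarith)
  pos ξ hξ := Real.rpow_pos_of_pos hξ _
  mono η ξ hη h := Real.rpow_le_rpow hη.le h (by linarith)
  quad η ξ hη h := by
    have hξ : 0 < ξ := hη.trans_le h
    have e : ∀ x : ℝ, 0 < x → x ^ (1 + θ) = x ^ 2 * x ^ (θ - 1) := fun x hx => by
      rw [← Real.rpow_two, ← Real.rpow_add hx]
      congr 1
      ring
    have h1 : ξ ^ (θ - 1) ≤ η ^ (θ - 1) := Real.rpow_le_rpow_of_nonpos hη h (by linarith)
    rw [e ξ hξ, e η hη]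
    have : ξ ^ 2 * η ^ 2 * ξ ^ (θ - 1) ≤ ξ ^ 2 * η ^ 2 * η ^ (θ - 1) := by gcongr
    linarith

theorem IsHeatWeight.min_one {ρ : ℝ → ℝ} (hρ : IsHeatWeight ρ) :
    IsHeatWeight fun ξ => min 1 (ρ ξ) where
  continuous := continuous_const.min hρ.continuous
  pos ξ hξ := lt_min one_pos (hρ.pos ξ hξ)
  mono η ξ hη h := min_le_min le_rfl (hρ.mono η ξ hη h)
  quad η ξ hη h := by
    have h1 := hρ.quad η ξ hη h
    have h2 : η ^ 2 ≤ ξ ^ 2 := by gcongr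
    rw [min_mul_of_nonneg _ _ (sq_nonneg η), min_mul_of_nonneg _ _ (sq_nonneg ξ), one_mul, one_mul]
    exact min_le_min h2 h1

/-! ### The complex and the real semigroup -/

theorem ofReal_mem_heatCone_of_ne_zero {t : ℝ≥0} (ht : t ≠ 0) : ((t : ℝ) : ℂ) ∈ heatCone :=
  ofReal_mem_heatCone (NNReal.coe_pos.2 (pos_iff_ne_zero.2 ht))

theorem heatOp_nnreal_add {ρ : ℝ → ℝ} (hρ : IsHeatWeight ρ) (s t : ℝ≥0) :
    heatOp ρ ((s + t : ℝ≥0) : ℝ) = (heatOp ρ (s : ℝ)).comp (heatOp ρ (t : ℝ)) := by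
  rcases eq_or_ne s 0 with rfl | hs
  · simp [heatOp_zero]
  rcases eq_or_ne t 0 with rfl | ht
  · simp [heatOp_zero]
  rw [← heatOp_add hρ (ofReal_mem_heatCone_of_ne_zero hs) (ofReal_mem_heatCone_of_ne_zero ht)]
  push_cast
  rfl

theorem tendsto_heatOp_nnreal {ρ : ℝ → ℝ} (hρ : IsHeatWeight ρ) (x : WeightedL2C ρ) :
    Tendsto (fun t : ℝ≥0 => heatOp ρ (t : ℝ) x) (𝓝[>] 0) (𝓝 x) := by
  refine (tendsto_heatOp_zero hρ x).comp (tendsto_nhdsWithin_iff.2 ⟨?_, ?_⟩)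
  · have : Continuous fun t : ℝ≥0 => ((t : ℝ) : ℂ) := by fun_prop
    simpa using (this.tendsto 0).mono_left nhdsWithin_le_nhds
  · filter_upwards [self_mem_nhdsWithin] with t ht
    exact ofReal_mem_heatCone_of_ne_zero (ne_of_gt ht)

/-- The Dirichlet heat semigroup on the complex space `L²(ρ dξ)`. -/
noncomputable def complexHeatSemigroup {ρ : ℝ → ℝ} (hρ : IsHeatWeight ρ) :
    C0Semigroup ℂ (WeightedL2C ρ) where
  op t := heatOp ρ (t : ℝ)
  op_zero := by simp [heatOp_zero]
  op_add := heatOp_nnreal_add hρ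
  tendsto_zero := tendsto_heatOp_nnreal hρ

theorem complexHeatSemigroup_isBoundedAnalytic {ρ : ℝ → ℝ} (hρ : IsHeatWeight ρ) :
    (complexHeatSemigroup hρ).IsBoundedAnalytic := by
  have hp := Real.pi_pos
  have hsub := openSector_subset_heatCone
  refine ⟨Real.pi / 3, by positivity, by linarith, heatOp ρ, fun t => rfl, fun z hz => ?_,
    fun z hz w hw => heatOp_add hρ (hsub hz) (hsub hw), fun x => ?_, 272 * √Real.pi,
    fun z hz => norm_heatOp_le hρ (hsub hz)⟩
  · exact (differentiableAt_heatOp hρ (hsub hz)).differentiableWithinAt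
  · exact (tendsto_heatOp_zero hρ x).mono_left (nhdsWithin_mono _ hsub)

/-- The real part, as a left inverse of `weightedOfReal`. -/
noncomputable def weightedRe (ρ : ℝ → ℝ) : WeightedL2C ρ →L[ℝ] WeightedL2 ρ :=
  Complex.reCLM.compLpL 2 (weightedMeasure ρ)

theorem coeFn_weightedOfReal {ρ : ℝ → ℝ} (f : WeightedL2 ρ) :
    weightedOfReal ρ f =ᵐ[weightedMeasure ρ] fun ξ => (f ξ : ℂ) :=
  ContinuousLinearMap.coeFn_compLpL _ f

theorem coeFn_weightedRe {ρ : ℝ → ℝ} (f : WeightedL2C ρ) :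
    weightedRe ρ f =ᵐ[weightedMeasure ρ] fun ξ => (f ξ).re :=
  ContinuousLinearMap.coeFn_compLpL _ f

theorem weightedRe_weightedOfReal {ρ : ℝ → ℝ} (f : WeightedL2 ρ) :
    weightedRe ρ (weightedOfReal ρ f) = f := by
  refine Lp.ext ?_
  filter_upwards [coeFn_weightedRe (weightedOfReal ρ f), coeFn_weightedOfReal f] with ξ h1 h2
  rw [h1, h2, Complex.ofReal_re]

/-- The heat semigroup on the real space `L²(ρ dξ)`, as the real part of the complex one. -/
noncomputable def heatOpReal (ρ : ℝ → ℝ) (t : ℝ) : WeightedL2 ρ →L[ℝ] WeightedL2 ρ :=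
  (weightedRe ρ).comp (((heatOp ρ t).restrictScalars ℝ).comp (weightedOfReal ρ))

theorem heatOpReal_apply (ρ : ℝ → ℝ) (t : ℝ) (f : WeightedL2 ρ) :
    heatOpReal ρ t f = weightedRe ρ (heatOp ρ t (weightedOfReal ρ f)) := rfl

theorem heatOp_weightedOfReal_ae {ρ : ℝ → ℝ} (hρ : IsHeatWeight ρ) {t : ℝ} (ht : 0 < t)
    (f : WeightedL2 ρ) : heatOp ρ t (weightedOfReal ρ f) =ᵐ[weightedMeasure ρ]
      fun ξ => ((∫ η in Ioi 0, dirichletHeatKernel t ξ η * f η : ℝ) : ℂ) := by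
  filter_upwards [hasKernel_heatOp hρ (ofReal_mem_heatCone ht) (weightedOfReal ρ f)] with ξ h
  rw [h.2, ← integral_complex_ofReal]
  refine integral_congr_ae ?_
  filter_upwards [hρ.ae_halfLine (coeFn_weightedOfReal f)] with η h
  rw [h, complexHeatKernel_ofReal ht, Complex.ofReal_mul]

theorem heatOpReal_ae {ρ : ℝ → ℝ} (hρ : IsHeatWeight ρ) {t : ℝ} (ht : 0 < t)
    (f : WeightedL2 ρ) : heatOpReal ρ t f =ᵐ[weightedMeasure ρ]
      fun ξ => ∫ η in Ioi 0, dirichletHeatKernel t ξ η * f η := by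
  filter_upwards [coeFn_weightedRe (heatOp ρ t (weightedOfReal ρ f)),
    heatOp_weightedOfReal_ae hρ ht f] with ξ h1 h2
  rw [heatOpReal_apply, h1, h2, Complex.ofReal_re]

/-- The complex semigroup maps real functions to real functions. -/
theorem weightedOfReal_heatOpReal {ρ : ℝ → ℝ} (hρ : IsHeatWeight ρ) (t : ℝ≥0)
    (f : WeightedL2 ρ) :
    weightedOfReal ρ (heatOpReal ρ t f) = heatOp ρ (t : ℝ) (weightedOfReal ρ f) := by
  rcases eq_or_ne t 0 with rfl | ht
  · rw [heatOpReal_apply]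
    simp [heatOp_zero, weightedRe_weightedOfReal]
  have ht' : (0 : ℝ) < t := NNReal.coe_pos.2 (pos_iff_ne_zero.2 ht)
  refine Lp.ext ?_
  filter_upwards [coeFn_weightedOfReal (heatOpReal ρ t f), heatOpReal_ae hρ ht' f,
    heatOp_weightedOfReal_ae hρ ht' f] with ξ h1 h2 h3
  rw [h1, h2, h3]

/-- The Dirichlet heat semigroup on the real space `L²(ρ dξ)`. -/
noncomputable def realHeatSemigroup {ρ : ℝ → ℝ} (hρ : IsHeatWeight ρ) :
    C0Semigroup ℝ (WeightedL2 ρ) where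
  op t := heatOpReal ρ t
  op_zero := by
    ext1 f
    simp [heatOpReal_apply, heatOp_zero, weightedRe_weightedOfReal]
  op_add s t := by
    ext1 f
    rw [ContinuousLinearMap.comp_apply, heatOpReal_apply, heatOpReal_apply,
      weightedOfReal_heatOpReal hρ, heatOp_nnreal_add hρ, ContinuousLinearMap.comp_apply]
  tendsto_zero f := by
    have := ((weightedRe ρ).continuous.tendsto _).comp
      (tendsto_heatOp_nnreal hρ (weightedOfReal ρ f))
    rwa [weightedRe_weightedOfReal] at this

theorem realHeatSemigroup_isBounded {ρ : ℝ → ℝ} (hρ : IsHeatWeight ρ) :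
    (realHeatSemigroup hρ).IsBounded := by
  refine ⟨‖weightedRe ρ‖ * (max 1 (272 * √Real.pi) * ‖weightedOfReal ρ‖), fun t => ?_⟩
  have h : ‖heatOp ρ (t : ℝ)‖ ≤ max 1 (272 * √Real.pi) := by
    rcases eq_or_ne t 0 with rfl | ht
    · rw [NNReal.coe_zero, Complex.ofReal_zero, heatOp_zero]
      exact ContinuousLinearMap.norm_id_le.trans (le_max_left _ _)
    · exact (norm_heatOp_le hρ (ofReal_mem_heatCone_of_ne_zero ht)).trans (le_max_right _ _)
  change ‖heatOpReal ρ t‖ ≤ _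
  refine (ContinuousLinearMap.opNorm_comp_le _ _).trans ?_
  gcongr
  refine (ContinuousLinearMap.opNorm_comp_le _ _).trans ?_
  rw [ContinuousLinearMap.norm_restrictScalars]
  gcongr

theorem realHeatSemigroup_extends {ρ : ℝ → ℝ} (hρ : IsHeatWeight ρ) :
    ExtendsDirichletHeat ρ (realHeatSemigroup hρ) := by
  intro t f _ hf
  rcases eq_or_ne t 0 with rfl | ht
  · rw [C0Semigroup.op_zero, ContinuousLinearMap.id_apply]
    filter_upwards [hf.coeFn_toLp] with ξ h
    rw [h, dirichletHeat, if_pos rfl]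
  · filter_upwards [heatOpReal_ae hρ (NNReal.coe_pos.2 (pos_iff_ne_zero.2 ht)) (hf.toLp f)]
      with ξ h
    rw [dirichletHeat, if_neg ht]
    refine h.trans (integral_congr_ae ?_)
    filter_upwards [hρ.ae_halfLine hf.coeFn_toLp] with η h
    rw [h]

/-- A semigroup extending the heat semigroup is determined by its values on test functions. -/
theorem ExtendsDirichletHeat.unique {ρ : ℝ → ℝ} (hρ : IsHeatWeight ρ)
    {S S' : C0Semigroup ℝ (WeightedL2 ρ)} (h : ExtendsDirichletHeat ρ S)
    (h' : ExtendsDirichletHeat ρ S') : S' = S := by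
  refine C0Semigroup.ext (funext fun t => ContinuousLinearMap.ext fun f => ?_)
  refine hρ.mem_of_isClosed (V := {f | S'.op t f = S.op t f})
    (isClosed_eq (S'.op t).continuous (S.op t).continuous) (fun g hg hgc hgL => ?_) f
  have hgH : MemLp g 2 halfLineMeasure :=
    (hg.memLp_of_hasCompactSupport (μ := volume) hgc).mono_measure Measure.restrict_le_self
  exact Lp.ext ((h' t g hgH hgL).trans (h t g hgH hgL).symm)

theorem isComplexification_heatSemigroup {ρ : ℝ → ℝ} (hρ : IsHeatWeight ρ) :
    IsComplexification ρ (realHeatSemigroup hρ) (complexHeatSemigroup hρ) := by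
  intro t f g
  rw [map_add, map_smul]
  exact (congrArg₂ (fun a b => a + Complex.I • b) (weightedOfReal_heatOpReal hρ t f)
    (weightedOfReal_heatOpReal hρ t g)).symm

theorem mainTheorem6 (θ : ℝ) (hθ0 : 0 < θ) (hθ1 : θ < 1) (ρ : ℝ → ℝ)
    (hρ : ρ = (fun ξ : ℝ => ξ ^ (1 + θ)) ∨ ρ = (fun ξ : ℝ => min 1 (ξ ^ (1 + θ)))) :
    ∃ S : C0Semigroup ℝ (WeightedL2 ρ),
      ExtendsDirichletHeat ρ S ∧
      (∀ S' : C0Semigroup ℝ (WeightedL2 ρ), ExtendsDirichletHeat ρ S' → S' = S) ∧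
      S.IsBounded ∧
      (∃ A : WeightedL2 ρ →ₗ.[ℝ] WeightedL2 ρ, S.IsGenerator A) ∧
      ∃ SC : C0Semigroup ℂ (WeightedL2C ρ),
        IsComplexification ρ S SC ∧ SC.IsBoundedAnalytic := by
  have hw : IsHeatWeight ρ := by
    rcases hρ with rfl | rfl
    · exact isHeatWeight_rpow hθ0 hθ1
    · exact (isHeatWeight_rpow hθ0 hθ1).min_one
  exact ⟨realHeatSemigroup hw, realHeatSemigroup_extends hw,
    fun S' hS' => (realHeatSemigroup_extends hw).unique hw hS', realHeatSemigroup_isBounded hw,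
    (realHeatSemigroup hw).exists_isGenerator, complexHeatSemigroup hw,
    isComplexification_heatSemigroup hw, complexHeatSemigroup_isBoundedAnalytic hw⟩
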